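/- Let $M=2^\lambda$ with $\lambda\ge 3$, let $\mathcal S=\{x_m=e^{j(2m-1)\pi/M}:1\le m\le M\}$ be the $M$-PSK signal set, and let $k,l\in\{1,\dots,M/2\}$ with $k\ne M/2$, $l\neq M/2$. For $s\in\mathbb C$, a singularity removal constraint for $s$ is a nonempty set of the form $\{(a,b)\in\{1,\dots,M\}^2: x_a+s x_b=z\}$, $z\in\mathbb C$. The vital graph $\mathcal G^V_s$ has as vertices the singularity removal constraints with at least two cells; two distinct vertices are adjacent iff they contain cells lying in a common row or a common column. A proper colouring of $\mathcal G^V_s$ with colours $1,\dots,8$ defines a partially filled $M\times M$ square: each cell of a vertex is filled with the colour of that vertex, and all other cells are empty. Consider one of the following two cases. (i) $s=\frac{\sin(\pi k/M)}{\sin(\pi l/M)}$ with $k=2^{m_1}a_1$, $l=2^{m_2}a_2$, $a_1,a_2$ odd, $1\le m_1<m_2$. Put $\varepsilon=0$. (ii) $s=\frac{\sin(\pi k/M)}{\sin(\pi l/M)}e^{j\pi/M}$, where one of $k,l$ is odd and the other is $2^m a$ with $a$ odd and $m\ge1$. Put $\varepsilon=1$. In both cases the vertices of $\mathcal G^V_s$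 are the following $2M$ pairwise distinct sets ($0\le i\le M-1$; row and column indices are reduced modulo $M$ to $\{1,\dots,M\}$): $$c_{i+1}=\left\{\left(i+1,\ i-\tfrac M2-\tfrac{k+\varepsilon-l}2+1\right),\ \left(i-k+1,\ i+\tfrac M2-\tfrac{k+\varepsilon+l}2+1\right)\right\},$$ $$c_{M+i+1}=\left\{\left(i+1,\ i-\tfrac{k+\varepsilon+l}2+1\right),\ \left(i-k+1,\ i-\tfrac{k+\varepsilon-l}2+1\right)\right\}.$$ Moreover, giving colours $1,\dots,8$ to the vertices $c_v$ with $v$ in the following sets $S_1,\dots,S_8$, respectively, is a proper colouring of $\mathcal G_s^V$, and the resulting partially filled square can be completed to an $M\times M$ Latin square with the $M$ symbols $1,\dots,M$ (every cell filled, no symbol repeated in any row or column, filled cells unchanged). In case (i), for $i,j\ge 1$ let $U_{i,j}=\{(j-1)2^{m_2+1}+(i-1)2^{m_1}+u:1\le u\le 2^{m_1}\}$. Then $S_1,S_2,S_3,S_4$ are the unions of the $U_{i,j}$ over $1\le j\le 2^{\lambda-m_2-1}$ and, respectively, $i$ odd in $[1,2^{m_2-m_1}]$; $i$ even in $[1,2^{m_2-m_1}]$;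 $i$ odd in $[2^{m_2-m_1}+1,2^{m_2-m_1+1}]$; $i$ even in $[2^{m_2-m_1}+1,2^{m_2-m_1+1}]$. Further $S_{q+4}=M+S_q$ for $1\le q\le4$. In case (ii), for $1\le i\le 2^{\lambda-m}$ let $U^{odd}_i=\{(i-1)2^m+u:1\le u\le 2^m,\ u\text{ odd}\}$ and $U^{even}_i=\{(i-1)2^m+u:1\le u\le 2^m,\ u\text{ even}\}$. Then $S_1=\bigcup_{i\text{ odd}}U_i^{odd}$, $S_2=\bigcup_{i\text{ even}}U_i^{odd}$, $S_3=\bigcup_{i\text{ odd}}U_i^{even}$, $S_4=\bigcup_{i\text{ even}}U_i^{even}$, and $S_{q+4}=M+S_q$ for $1\le q\le 4$. -/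

import Mathlib

/-! A labelled signal set is a map `x : ι → ℂ`; the cell `(a, b)` of an `ι × ι` square stands for
the pair of transmitted points `(x a, x b)`. Symbols of squares are positive natural numbers. -/

/-- A (nonempty) singularity removal constraint for the fade state `s`. -/
def IsConstraint {ι : Type*} (x : ι → ℂ) (s : ℂ) (c : Finset (ι × ι)) : Prop :=
  c.Nonempty ∧
  (∀ p ∈ c, ∀ p' ∈ c, x p.1 + s * x p.2 = x p'.1 + s * x p'.2) ∧
  (∀ p ∈ c, ∀ p' ∉ c, x p.1 + s * x p.2 ≠ x p'.1 + s * x p'.2)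

/-- The singularity removal graph. -/
def removalGraph {ι : Type*} (x : ι → ℂ) (s : ℂ) :
    SimpleGraph {c : Finset (ι × ι) // IsConstraint x s c} where
  Adj c d := c ≠ d ∧ ∃ p ∈ c.1, ∃ p' ∈ d.1, p.1 = p'.1 ∨ p.2 = p'.2
  symm := ⟨by
    rintro c d ⟨hne, p, hp, p', hp', h⟩
    exact ⟨hne.symm, p', hp', p, hp, h.imp Eq.symm Eq.symm⟩⟩
  loopless := ⟨fun c h => h.1 rfl⟩

/-- The vital subgraph: the subgraph induced by the constraints with at least two cells. -/
def vitalGraph {ι : Type*} (x : ι → ℂ) (s : ℂ) :=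
  (removalGraph x s).induce {c | 2 ≤ c.1.card}

open Classical in
/-- The singularity removal constraint that contains the cell `p`. -/
noncomputable def constraintOf {ι : Type*} [Fintype ι] (x : ι → ℂ) (s : ℂ) (p : ι × ι) :
    {c : Finset (ι × ι) // IsConstraint x s c} :=
  ⟨Finset.univ.filter fun p' => x p'.1 + s * x p'.2 = x p.1 + s * x p.2, by
    refine ⟨⟨p, by simp⟩, ?_, ?_⟩
    · intro q hq q' hq'
      simp only [Finset.mem_filter, Finset.mem_univ, true_and] at hq hq'
      rw [hq, hq']
    · intro q hq q' hq' h
      simp only [Finset.mem_filter, Finset.mem_univ, true_and] at hq hq'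
      exact hq' (h.symm.trans hq)⟩

/-- The partially filled square given by a colouring of the vital subgraph with `n` colours: the
cells of a constraint with at least two cells carry the colour of that constraint (colours are
labelled `1, …, n`), all other cells are empty. -/
noncomputable def partialSquare {ι : Type*} [Fintype ι] {x : ι → ℂ} {s : ℂ} {n : ℕ}
    (κ : (vitalGraph x s).Coloring (Fin n)) (a b : ι) : Option ℕ :=
  if h : 2 ≤ (constraintOf x s (a, b)).1.card then
    some ((κ ⟨constraintOf x s (a, b), h⟩ : ℕ) + 1)
  else none

/-- A Latin square with symbols `1, …, t`. -/
def IsLatinSquare {ι : Type*} (t : ℕ) (f : ι → ι → ℕ) : Prop :=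
  (∀ a b, f a b ∈ Set.Icc 1 t) ∧
  (∀ a, Function.Injective fun b => f a b) ∧
  (∀ b, Function.Injective fun a => f a b)

/-- A partially filled square can be completed to a Latin square with symbols `1, …, t`. -/
def Completable {ι : Type*} (t : ℕ) (L : ι → ι → Option ℕ) : Prop :=
  ∃ f : ι → ι → ℕ, IsLatinSquare t f ∧ ∀ a b q, L a b = some q → f a b = q

/-- `c 1, …, c n` lists, without repetition, the constraints with at least two cells. -/
def IsVitalLabelling {ι : Type*} (x : ι → ℂ) (s : ℂ) (n : ℕ) (c : ℕ → Finset (ι × ι)) : Prop :=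
  Set.BijOn c (Set.Icc 1 n) {d | IsConstraint x s d ∧ 2 ≤ d.card}

/-- With respect to the labelling `c 1, …, c n` of the vertices of the vital subgraph, the vertices
of colour `q` under `κ` are those whose label lies in `S q`. -/
def HasColorClasses {ι : Type*} {x : ι → ℂ} {s : ℂ} {t : ℕ}
    (κ : (vitalGraph x s).Coloring (Fin t)) (n : ℕ) (c : ℕ → Finset (ι × ι))
    (S : Fin t → Set ℕ) : Prop :=
  ∀ w, ∀ v ∈ Set.Icc 1 n, w.1.1 = c v → ∀ q, κ w = q ↔ v ∈ S q

/-- The `M`-PSK signal set; the label `m ∈ {1, …, M}` of a point is represented by the residue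
`m - 1`. -/
noncomputable def psk (M : ℕ) (r : ZMod M) : ℂ :=
  Complex.exp (Complex.I * ((2 * (r.val : ℝ) + 1) * Real.pi / M : ℝ))

/-- The fade state `sin (π k / M) / sin (π l / M)`. -/
noncomputable def fadeEven (M k l : ℕ) : ℂ :=
  (Real.sin (Real.pi * k / M) / Real.sin (Real.pi * l / M) : ℝ)

/-- The fade state `sin (π k / M) / sin (π l / M) * exp (j π / M)`. -/
noncomputable def fadeMixed (M k l : ℕ) : ℂ :=
  fadeEven M k l * Complex.exp (Complex.I * (Real.pi / M : ℝ))

/-- The labelled constraints `c 1, …, c (2 * M)`, where `e = 0` if `k`, `l` have the same parity and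
`e = 1` otherwise (so that the divisions by two are exact). Label `i + 1` is the first kind of
constraint and label `M + i + 1` the second, `0 ≤ i < M`; rows and columns are residues mod `M`. -/
def pskConstraint (M : ℕ) (e k l : ℤ) (v : ℕ) : Finset (ZMod M × ZMod M) :=
  if v ≤ M then
    let i : ℤ := v - 1
    {(((i : ℤ) : ZMod M), ((i - M / 2 - (k + e - l) / 2 : ℤ) : ZMod M)),
      (((i - k : ℤ) : ZMod M), ((i + M / 2 - (k + e + l) / 2 : ℤ) : ZMod M))}
  else
    let i : ℤ := v - M - 1
    {(((i : ℤ) : ZMod M), ((i - (k + e + l) / 2 : ℤ) : ZMod M)),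
      (((i - k : ℤ) : ZMod M), ((i - (k + e - l) / 2 : ℤ) : ZMod M))}

/-- The set `U_{i,j}` (for `off = 0`) and `V_{i,j}` (for `off = M`), `i, j ≥ 1`. -/
def block2 (off m₁ m₂ i j : ℕ) : Set ℕ :=
  Set.Icc (off + (j - 1) * 2 ^ (m₂ + 1) + (i - 1) * 2 ^ m₁ + 1)
    (off + (j - 1) * 2 ^ (m₂ + 1) + i * 2 ^ m₁)

/-- The union of the blocks `(i, j)` with `lo ≤ i ≤ hi`, `i` of the given parity, and
`1 ≤ j ≤ 2 ^ (lam - m₂ - 1)`. -/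
def blockUnion2 (lam m₁ m₂ off lo hi : ℕ) (parity : ℕ → Prop) : Set ℕ :=
  {v | ∃ i j, lo ≤ i ∧ i ≤ hi ∧ parity i ∧ 1 ≤ j ∧ j ≤ 2 ^ (lam - m₂ - 1) ∧
    v ∈ block2 off m₁ m₂ i j}

/-- The eight colour classes for `k`, `l` both even, with 2-adic valuations `m₁ < m₂`. -/
def evenClasses (lam m₁ m₂ : ℕ) : Fin 8 → Set ℕ :=
  ![blockUnion2 lam m₁ m₂ 0 1 (2 ^ (m₂ - m₁)) Odd,
    blockUnion2 lam m₁ m₂ 0 1 (2 ^ (m₂ - m₁)) Even,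
    blockUnion2 lam m₁ m₂ 0 (2 ^ (m₂ - m₁) + 1) (2 ^ (m₂ - m₁ + 1)) Odd,
    blockUnion2 lam m₁ m₂ 0 (2 ^ (m₂ - m₁) + 1) (2 ^ (m₂ - m₁ + 1)) Even,
    blockUnion2 lam m₁ m₂ (2 ^ lam) 1 (2 ^ (m₂ - m₁)) Odd,
    blockUnion2 lam m₁ m₂ (2 ^ lam) 1 (2 ^ (m₂ - m₁)) Even,
    blockUnion2 lam m₁ m₂ (2 ^ lam) (2 ^ (m₂ - m₁) + 1) (2 ^ (m₂ - m₁ + 1)) Odd,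
    blockUnion2 lam m₁ m₂ (2 ^ lam) (2 ^ (m₂ - m₁) + 1) (2 ^ (m₂ - m₁ + 1)) Even]

/-- The union, over `1 ≤ i ≤ 2 ^ (lam - m)` with `i` of the given parity, of the sets
`{off + (i - 1) 2 ^ m + u, off + (i - 1) 2 ^ m + u + 2, …}` of numbers up to `off + i 2 ^ m`; here
`u = 1` gives the odd and `u = 2` the even half of a block. -/
def blockUnion1 (lam m off u : ℕ) (parity : ℕ → Prop) : Set ℕ :=
  {v | ∃ i, 1 ≤ i ∧ i ≤ 2 ^ (lam - m) ∧ parity i ∧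
    ∃ t, v = off + (i - 1) * 2 ^ m + u + 2 * t ∧ v ≤ off + i * 2 ^ m}

/-- The eight colour classes for `k`, `l` of different parity, the even one having 2-adic
valuation `m`. -/
def mixedClasses (lam m : ℕ) : Fin 8 → Set ℕ :=
  ![blockUnion1 lam m 0 1 Odd, blockUnion1 lam m 0 1 Even,
    blockUnion1 lam m 0 2 Odd, blockUnion1 lam m 0 2 Even,
    blockUnion1 lam m (2 ^ lam) 1 Odd, blockUnion1 lam m (2 ^ lam) 1 Even,
    blockUnion1 lam m (2 ^ lam) 2 Odd, blockUnion1 lam m (2 ^ lam) 2 Even]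

/-!
Two pairs of PSK points collide at the fade state `s` iff `x a - x a' = s (x b' - x b)`. The
difference of PSK points with labels `d` apart is `2 i sin (π d / M)` times a power of
`exp (i π / M)`, so taking norms gives
`sin (π |d| / M) sin (π l / M) = sin (π k / M) sin (π |c| / M)`. Writing products of sines as
differences of cosines and using that `cos (π j / M)`, `0 ≤ j < M / 2`, are linearly independent
over `ℚ`, one gets `|d| = k` and `|c| = l`, the other solution `|d| = |c|` being excluded by
`k ≠ l`. Comparing phases then leaves exactly the listed two-cell constraints.

The colour of a vertex consists of its kind and of two binary digits of its index `i`, at the 2-adic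
valuations of `k` and `l`. The cells of the vertices of one kind lie on two cyclic diagonals
`b - a = const`. Together with four further diagonals, suitably filled with colours of vertices of
shifted index, these four diagonals carry each of the eight symbols once in every row and every
column, because adding an odd multiple of `2 ^ p` changes the binary digit `p`. Each of the `M - 8`
remaining diagonals is filled with a symbol of its own.
-/

theorem eq_zero_of_aeval_primitiveRoot_eq_zero {K : Type*} [Field K] [CharZero K] {N : ℕ} {ζ : K}
    (hζ : IsPrimitiveRoot ζ N) (hN : 0 < N) {P : Polynomial ℚ} (hP : Polynomial.aeval ζ P = 0)
    (hdeg : P.natDegree < N.totient) : P = 0 := by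
  by_contra hne
  have hle := Polynomial.natDegree_le_of_dvd (minpoly.dvd ℚ ζ hP) hne
  rw [← Polynomial.cyclotomic_eq_minpoly_rat hζ hN, Polynomial.natDegree_cyclotomic] at hle
  omega

open Polynomial in
/-- Multiplying `∑ j, c j * 2 * cos (j θ)`, `θ = π / 2 ^ (n + 1)`, by `exp (i (2 ^ n - 1) θ)` gives
the value of this polynomial at `exp (i θ)`. -/
noncomputable def cosPolynomial (n : ℕ) (c : Fin (2 ^ n) → ℚ) : ℚ[X] :=
  ∑ j, C (c j) * (X ^ (2 ^ n - 1 + j : ℕ) + X ^ (2 ^ n - 1 - j : ℕ))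

theorem natDegree_cosPolynomial_lt (n : ℕ) (c : Fin (2 ^ n) → ℚ) :
    (cosPolynomial n c).natDegree < 2 ^ (n + 1) := by
  have : 2 ^ (n + 1) = 2 * 2 ^ n := pow_succ' 2 n
  have : 0 < 2 ^ n := by positivity
  suffices h : (cosPolynomial n c).natDegree ≤ 2 ^ (n + 1) - 2 by omega
  refine Polynomial.natDegree_sum_le_of_forall_le _ _ fun j _ => ?_
  refine (Polynomial.natDegree_C_mul_le _ _).trans ((Polynomial.natDegree_add_le _ _).trans ?_)
  simp only [Polynomial.natDegree_X_pow]
  omega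

theorem coeff_cosPolynomial (n : ℕ) (c : Fin (2 ^ n) → ℚ) (j : Fin (2 ^ n)) :
    (cosPolynomial n c).coeff (2 ^ n - 1 + j) = if (j : ℕ) = 0 then 2 * c j else c j := by
  simp only [cosPolynomial, Polynomial.finsetSum_coeff, Polynomial.coeff_C_mul,
    Polynomial.coeff_add, Polynomial.coeff_X_pow]
  rw [Finset.sum_eq_single_of_mem j (Finset.mem_univ j) fun i _ hij => ?_]
  · split_ifs <;> first | omega | ring
  · have hij' : (i : ℕ) ≠ j := fun h => hij (Fin.ext h)
    rw [if_neg (by omega), if_neg (by omega), add_zero, mul_zero]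

theorem aeval_cosPolynomial {n : ℕ} (c : Fin (2 ^ n) → ℚ) {ζ : ℂ} (hζ : ζ ≠ 0)
    {x : Fin (2 ^ n) → ℝ} (hx : ∀ j : Fin (2 ^ n), ζ ^ (j : ℕ) + ζ⁻¹ ^ (j : ℕ) = 2 * x j) :
    Polynomial.aeval ζ (cosPolynomial n c) = ζ ^ (2 ^ n - 1) * 2 * ((∑ j, c j • x j : ℝ) : ℂ) := by
  simp only [cosPolynomial, map_sum, Complex.ofReal_sum, Finset.mul_sum]
  refine Finset.sum_congr rfl fun j _ => ?_
  rw [map_mul, Polynomial.aeval_C, map_add, map_pow, map_pow, Polynomial.aeval_X, pow_add ζ _ j,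
    pow_sub₀ ζ hζ (Nat.le_sub_one_of_lt j.2), ← inv_pow, ← mul_add, hx, Rat.smul_def,
    Complex.ofReal_mul, Complex.ofReal_ratCast, eq_ratCast]
  ring

theorem linearIndependent_cos (n : ℕ) : LinearIndependent ℚ
    fun j : Fin (2 ^ n) => Real.cos (Real.pi * (j : ℕ) / (2 ^ (n + 1) : ℕ)) := by
  rw [Fintype.linearIndependent_iff]
  intro c hc j
  let ζ : ℂ := Complex.exp (2 * Real.pi * Complex.I / (2 ^ (n + 2) : ℕ))
  have hζ : IsPrimitiveRoot ζ (2 ^ (n + 2)) := Complex.isPrimitiveRoot_exp _ (by positivity)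
  have hcos (i : ℕ) : ζ ^ i + ζ⁻¹ ^ i
      = 2 * (Real.cos (Real.pi * i / (2 ^ (n + 1) : ℕ)) : ℝ) := by
    rw [Complex.ofReal_cos, Complex.two_cos, ← Complex.exp_neg, ← Complex.exp_nat_mul,
      ← Complex.exp_nat_mul]
    congr 2 <;> (push_cast; ring)
  have hroot : Polynomial.aeval ζ (cosPolynomial n c) = 0 := by
    rw [aeval_cosPolynomial c (Complex.exp_ne_zero _) fun j => hcos j, hc, Complex.ofReal_zero,
      mul_zero]
  have hzero : cosPolynomial n c = 0 := by
    refine eq_zero_of_aeval_primitiveRoot_eq_zero hζ (by positivity) hroot ?_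
    rw [Nat.totient_prime_pow_succ Nat.prime_two, Nat.add_one_sub_one, mul_one]
    exact natDegree_cosPolynomial_lt n c
  have hcoeff := coeff_cosPolynomial n c j
  rw [hzero, Polynomial.coeff_zero] at hcoeff
  split_ifs at hcoeff <;> linarith

/-- The coefficients of `cos (B θ)`, `0 ≤ B ≤ 2 ^ (n + 1)`, in the basis `cos (j θ)`, `j < 2 ^ n`,
where `θ = π / 2 ^ (n + 1)`. -/
def acuteCoeff (n B : ℕ) (j : Fin (2 ^ n)) : ℤ :=
  (if (j : ℕ) = B then 1 else 0) - (if (j : ℕ) + B = 2 ^ (n + 1) then 1 else 0)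

theorem cos_eq_sum_acuteCoeff {n B : ℕ} (hB : B ≤ 2 ^ (n + 1)) :
    Real.cos (Real.pi * B / (2 ^ (n + 1) : ℕ))
      = ∑ j, acuteCoeff n B j • Real.cos (Real.pi * (j : ℕ) / (2 ^ (n + 1) : ℕ)) := by
  have hpow : 2 ^ (n + 1) = 2 * 2 ^ n := pow_succ' 2 n
  have hM : ((2 ^ (n + 1) : ℕ) : ℝ) ≠ 0 := by positivity
  have hcoeff (j : Fin (2 ^ n)) (hj : (j : ℕ) ≠ B) (hj' : (j : ℕ) + B ≠ 2 ^ (n + 1)) :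
      acuteCoeff n B j • Real.cos (Real.pi * (j : ℕ) / (2 ^ (n + 1) : ℕ)) = 0 := by
    rw [acuteCoeff, if_neg hj, if_neg hj', sub_zero, zero_smul]
  rcases lt_trichotomy B (2 ^ n) with h | h | h
  · rw [Finset.sum_eq_single_of_mem ⟨B, h⟩ (Finset.mem_univ _) fun i _ hi =>
      hcoeff i (fun e => hi (Fin.ext e)) (by omega)]
    rw [acuteCoeff, if_pos rfl, if_neg (by simp only; omega), sub_zero, one_smul]
  · rw [Finset.sum_eq_zero fun i _ => hcoeff i (by omega) (by omega),
      show Real.pi * B / (2 ^ (n + 1) : ℕ) = Real.pi / 2 by rw [hpow, h]; push_cast; field_simp,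
      Real.cos_pi_div_two]
  · rw [Finset.sum_eq_single_of_mem ⟨2 ^ (n + 1) - B, by omega⟩ (Finset.mem_univ _) fun i _ hi =>
      hcoeff i (by omega) fun e => hi (Fin.ext (by simp only; omega))]
    rw [acuteCoeff, if_neg (by simp only; omega), if_pos (by simp only; omega), zero_sub, neg_smul,
      one_smul, Nat.cast_sub hB, mul_sub, sub_div, mul_div_cancel_right₀ _ hM, Real.cos_pi_sub,
      neg_neg]

theorem acuteCoeff_sub_eq_of_cos_sub_eq {n A B C D : ℕ} (hA : A ≤ 2 ^ (n + 1))
    (hB : B ≤ 2 ^ (n + 1)) (hC : C ≤ 2 ^ (n + 1)) (hD : D ≤ 2 ^ (n + 1))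
    (h : Real.cos (Real.pi * A / (2 ^ (n + 1) : ℕ)) - Real.cos (Real.pi * B / (2 ^ (n + 1) : ℕ))
      = Real.cos (Real.pi * C / (2 ^ (n + 1) : ℕ)) - Real.cos (Real.pi * D / (2 ^ (n + 1) : ℕ))) :
    acuteCoeff n A - acuteCoeff n B = acuteCoeff n C - acuteCoeff n D := by
  have hind := (LinearIndependent.iff_fractionRing ℤ ℚ).2 (linearIndependent_cos n)
  apply linearIndependent_iff_injective_fintypeLinearCombination.1 hind
  simpa only [map_sub, Fintype.linearCombination_apply, ← cos_eq_sum_acuteCoeff, hA, hB, hC, hD]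
    using h

theorem eq_and_eq_of_acuteCoeff_sub_eq {n A B C D : ℕ} (hA : A < 2 ^ n) (hC : C < 2 ^ n)
    (hAB : A < B) (hCD : C < D) (hAB' : A + B ≤ 2 ^ (n + 1)) (hCD' : C + D ≤ 2 ^ (n + 1))
    (h : acuteCoeff n A - acuteCoeff n B = acuteCoeff n C - acuteCoeff n D) : A = C ∧ B = D := by
  have : 2 ^ (n + 1) = 2 * 2 ^ n := pow_succ' 2 n
  have hcoeff (j : ℕ) (hj : j < 2 ^ n) := congrFun h ⟨j, hj⟩
  simp only [Pi.sub_apply, acuteCoeff] at hcoeff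
  have hAC : A = C := by
    have hatA := hcoeff A hA
    have hatC := hcoeff C hC
    omega
  refine ⟨hAC, ?_⟩
  by_contra hBD
  by_cases hB : B < 2 ^ n
  · have hatB := hcoeff B hB
    by_cases hD : D < 2 ^ n
    · have hatD := hcoeff D hD
      omega
    · omega
  · by_cases hB' : B = 2 ^ n
    · by_cases hD : D < 2 ^ n
      · have hatD := hcoeff D hD
        omega
      · have hatD := hcoeff (2 ^ (n + 1) - D) (by omega)
        omega
    · have hatB := hcoeff (2 ^ (n + 1) - B) (by omega)
      omega

/-- Half the distance between two `M`-PSK points whose labels differ by `d`; it carries the sign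
of `sin (π d / M)`, so that it is odd in `d`. -/
noncomputable def halfChord (M : ℕ) (d : ℤ) : ℝ :=
  Real.sin (Real.pi * d / M)

theorem halfChord_neg (M : ℕ) (d : ℤ) : halfChord M (-d) = -halfChord M d := by
  rw [halfChord, halfChord, Int.cast_neg, mul_neg, neg_div, Real.sin_neg]

theorem halfChord_zero (M : ℕ) : halfChord M 0 = 0 := by
  rw [halfChord, Int.cast_zero, mul_zero, zero_div, Real.sin_zero]

theorem halfChord_pos {M : ℕ} {d : ℤ} (hd : 0 < d) (hdM : d < M) : 0 < halfChord M d := by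
  have hM : (0 : ℝ) < M := by exact_mod_cast hd.trans hdM
  have : (0 : ℝ) < d := by exact_mod_cast hd
  have hdM' : (d : ℝ) < M := by exact_mod_cast hdM
  refine Real.sin_pos_of_pos_of_lt_pi (by positivity) ?_
  rw [div_lt_iff₀ hM]
  gcongr

theorem halfChord_natCast_pos {n d : ℕ} (hd : d ∈ Set.Icc 1 (2 ^ n)) :
    0 < halfChord (2 ^ (n + 1)) d :=
  halfChord_pos (by exact_mod_cast hd.1)
    (by exact_mod_cast hd.2.trans_lt (Nat.pow_lt_pow_succ one_lt_two))

theorem abs_halfChord {M : ℕ} {d : ℤ} (hd : d.natAbs < M) :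
    |halfChord M d| = halfChord M d.natAbs := by
  have hnonneg : 0 ≤ halfChord M d.natAbs := by
    rcases Nat.eq_zero_or_pos d.natAbs with h | h
    · rw [h, Nat.cast_zero, halfChord_zero]
    · exact (halfChord_pos (by exact_mod_cast h) (by exact_mod_cast hd)).le
  rcases Int.natAbs_eq d with h | h
  · rw [← h] at hnonneg ⊢
    exact abs_of_nonneg hnonneg
  · rw [h, halfChord_neg, abs_neg, Int.natAbs_neg, Int.natAbs_natCast, abs_of_nonneg hnonneg]

theorem two_mul_halfChord_mul_halfChord (M : ℕ) {x y : ℕ} (hxy : x ≤ y) :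
    2 * (halfChord M y * halfChord M x)
      = Real.cos (Real.pi * (y - x : ℕ) / M) - Real.cos (Real.pi * (y + x : ℕ) / M) := by
  rw [Nat.cast_sub hxy, Nat.cast_add, halfChord, halfChord, mul_sub, mul_add, sub_div, add_div,
    Real.cos_sub, Real.cos_add, Int.cast_natCast, Int.cast_natCast]
  ring

theorem eq_and_eq_of_halfChord_mul_eq_of_le {n a b c d : ℕ} (hb : 0 < b) (hd : 0 < d) (hba : b ≤ a)
    (hdc : d ≤ c) (ha : a ≤ 2 ^ n) (hc : c ≤ 2 ^ n)
    (h : halfChord (2 ^ (n + 1)) a * halfChord (2 ^ (n + 1)) b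
      = halfChord (2 ^ (n + 1)) c * halfChord (2 ^ (n + 1)) d) : a = c ∧ b = d := by
  have : 2 ^ (n + 1) = 2 * 2 ^ n := pow_succ' 2 n
  have hcos := congrArg (2 * ·) h
  simp only [two_mul_halfChord_mul_halfChord, hba, hdc] at hcos
  have hcoeff := acuteCoeff_sub_eq_of_cos_sub_eq (by omega) (by omega) (by omega) (by omega) hcos
  have := eq_and_eq_of_acuteCoeff_sub_eq (by omega) (by omega) (by omega) (by omega) (by omega)
    (by omega) hcoeff
  omega

theorem halfChord_mul_halfChord_inj {n a b c d : ℕ} (ha : a ∈ Set.Icc 1 (2 ^ n))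
    (hb : b ∈ Set.Icc 1 (2 ^ n)) (hc : c ∈ Set.Icc 1 (2 ^ n)) (hd : d ∈ Set.Icc 1 (2 ^ n))
    (h : halfChord (2 ^ (n + 1)) a * halfChord (2 ^ (n + 1)) b
      = halfChord (2 ^ (n + 1)) c * halfChord (2 ^ (n + 1)) d) :
    a = c ∧ b = d ∨ a = d ∧ b = c := by
  wlog hba : b ≤ a generalizing a b
  · have := this hb ha (by rw [mul_comm, h]) (Nat.le_of_not_le hba)
    tauto
  wlog hdc : d ≤ c generalizing c d
  · have := this hd hc (by rw [h, mul_comm]) (Nat.le_of_not_le hdc)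
    tauto
  exact .inl (eq_and_eq_of_halfChord_mul_eq_of_le hb.1 hd.1 hba hdc ha.2 hc.2 h)

/-- The primitive `2 * M`-th root of unity whose odd powers are the `M`-PSK points. -/
noncomputable def pskRoot (M : ℕ) : ℂ :=
  Complex.exp (Real.pi * Complex.I / M)

/-- The signal received when the pair `p` is transmitted in the fade state `s`. The singularity
removal constraints are its nonempty fibres. -/
def superposition {ι : Type*} (x : ι → ℂ) (s : ℂ) (p : ι × ι) : ℂ :=
  x p.1 + s * x p.2

section PSK

variable {M : ℕ}

theorem pskRoot_ne_zero : pskRoot M ≠ 0 :=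
  Complex.exp_ne_zero _

theorem norm_pskRoot : ‖pskRoot M‖ = 1 := by
  rw [pskRoot, mul_div_right_comm, ← Complex.ofReal_natCast, ← Complex.ofReal_div,
    Complex.norm_exp_ofReal_mul_I]

theorem pskRoot_zpow_sub_zpow_neg (d : ℤ) :
    pskRoot M ^ d - pskRoot M ^ (-d) = 2 * Complex.I * halfChord M d := by
  have hsin := Complex.two_sin (Real.pi * d / M : ℝ)
  have hexp : (d : ℂ) * (Real.pi * Complex.I / M) = (Real.pi * d / M : ℝ) * Complex.I := by
    push_cast
    ring
  rw [halfChord, Complex.ofReal_sin, pskRoot, ← Complex.exp_int_mul, ← Complex.exp_int_mul,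
    Int.cast_neg, neg_mul, hexp, ← neg_mul]
  linear_combination -Complex.I * hsin +
    (Complex.exp ((Real.pi * d / M : ℝ) * Complex.I) -
      Complex.exp (-(Real.pi * d / M : ℝ) * Complex.I)) * Complex.I_sq

variable [NeZero M]

theorem isPrimitiveRoot_pskRoot : IsPrimitiveRoot (pskRoot M) (2 * M) := by
  have h := Complex.isPrimitiveRoot_exp (2 * M) (mul_ne_zero two_ne_zero (NeZero.ne M))
  rwa [Nat.cast_mul, Nat.cast_ofNat, mul_assoc, mul_div_mul_left _ _ two_ne_zero] at h

theorem pskRoot_zpow_eq_zpow_iff {a b : ℤ} :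
    pskRoot M ^ a = pskRoot M ^ b ↔ (2 * M : ℤ) ∣ a - b := by
  rw [← div_eq_one_iff_eq (zpow_ne_zero b pskRoot_ne_zero), ← zpow_sub₀ pskRoot_ne_zero,
    isPrimitiveRoot_pskRoot.zpow_eq_one_iff_dvd, Nat.cast_mul, Nat.cast_ofNat]

theorem pskRoot_zpow_natCast_self : pskRoot M ^ (M : ℤ) = -1 := by
  have hM : (M : ℂ) ≠ 0 := NeZero.ne _
  rw [zpow_natCast, pskRoot, ← Complex.exp_nat_mul, mul_div_cancel₀ _ hM, Complex.exp_pi_mul_I]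

theorem psk_intCast (a : ℤ) : psk M a = pskRoot M ^ (2 * a + 1) := by
  have hval : psk M a = pskRoot M ^ (2 * ((a : ZMod M).val : ℤ) + 1) := by
    rw [psk, pskRoot, ← Complex.exp_int_mul]
    congr 1
    push_cast
    ring
  rw [hval, pskRoot_zpow_eq_zpow_iff, ZMod.val_intCast]
  refine ⟨-(a / M), ?_⟩
  linear_combination 2 * Int.emod_add_mul_ediv a M

theorem psk_sub_psk (a b : ℤ) :
    psk M a - psk M b = pskRoot M ^ (a + b + 1) * (2 * Complex.I * halfChord M (a - b)) := by
  rw [psk_intCast, psk_intCast, ← pskRoot_zpow_sub_zpow_neg, mul_sub, ← zpow_add₀ pskRoot_ne_zero,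
    ← zpow_add₀ pskRoot_ne_zero]
  ring_nf

/-- The fade state `sin (π k / M) / sin (π l / M) * exp (i π e / M)`: the common form of `fadeEven`
and `fadeMixed`, closed under changing the sign of `l`. -/
noncomputable def fadeState (M : ℕ) (k l e : ℤ) : ℂ :=
  (halfChord M k / halfChord M l : ℝ) * pskRoot M ^ e

omit [NeZero M] in
theorem fadeState_zero (k l : ℕ) : fadeState M k l 0 = fadeEven M k l := by
  simp only [fadeState, fadeEven, halfChord, zpow_zero, mul_one, Int.cast_natCast]

omit [NeZero M] in
theorem fadeState_one (k l : ℕ) : fadeState M k l 1 = fadeMixed M k l := by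
  rw [fadeMixed, ← fadeState_zero, fadeState, fadeState, zpow_zero, mul_one, zpow_one, pskRoot]
  congr 2
  push_cast
  ring

theorem fadeState_neg_add (k l e : ℤ) : fadeState M k (-l) (e + M) = fadeState M k l e := by
  rw [fadeState, fadeState, halfChord_neg, zpow_add₀ pskRoot_ne_zero, pskRoot_zpow_natCast_self,
    div_neg, Complex.ofReal_neg]
  ring

theorem superposition_eq_iff_halfChord {k l e : ℤ} (hl : halfChord M l ≠ 0) (a b a' b' : ℤ) :
    superposition (psk M) (fadeState M k l e) (a, b)
        = superposition (psk M) (fadeState M k l e) (a', b') ↔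
      (halfChord M (a - a') * halfChord M l : ℝ) * pskRoot M ^ (a + a')
        = (halfChord M k * halfChord M (b' - b) : ℝ) * pskRoot M ^ (b' + b + e) := by
  have hl' : (halfChord M l : ℂ) ≠ 0 := Complex.ofReal_ne_zero.2 hl
  have hdiff : superposition (psk M) (fadeState M k l e) (a, b)
        = superposition (psk M) (fadeState M k l e) (a', b') ↔
      psk M a - psk M a' = fadeState M k l e * (psk M b' - psk M b) := by
    rw [superposition, superposition]
    constructor <;> intro h <;> linear_combination h
  have hζ : pskRoot M ≠ 0 := pskRoot_ne_zero
  rw [hdiff, psk_sub_psk, psk_sub_psk, fadeState, zpow_add_one₀ hζ, zpow_add_one₀ hζ,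
    zpow_add₀ hζ (b' + b), Complex.ofReal_div]
  push_cast
  field_simp

theorem superposition_eq_iff_eq_sub {k l e h : ℤ} (hk : halfChord M k ≠ 0) (hl : halfChord M l ≠ 0)
    (hh : 2 * h = k + e + l) (a b : ZMod M) :
    superposition (psk M) (fadeState M k l e) (a, b)
        = superposition (psk M) (fadeState M k l e) (a - k, b + l) ↔ b = a - h := by
  obtain ⟨a, rfl⟩ := ZMod.intCast_surjective a
  obtain ⟨b, rfl⟩ := ZMod.intCast_surjective b
  have hexp : a + (a - k) - (b + l + b + e) = 2 * (a - h - b) := by linear_combination hh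
  rw [← Int.cast_sub, ← Int.cast_add, ← Int.cast_sub, superposition_eq_iff_halfChord hl,
    sub_sub_cancel, add_sub_cancel_left, mul_right_inj' (by exact_mod_cast mul_ne_zero hk hl),
    pskRoot_zpow_eq_zpow_iff, hexp, mul_dvd_mul_iff_left two_ne_zero,
    ZMod.intCast_eq_intCast_iff_dvd_sub]

theorem abs_halfChord_mul_eq_of_superposition_eq {k l e : ℤ} (hk : 0 ≤ halfChord M k)
    (hl : 0 < halfChord M l) {a b : ZMod M} {c d : ℤ}
    (h : superposition (psk M) (fadeState M k l e) (a, b)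
      = superposition (psk M) (fadeState M k l e) (a - d, b - c)) :
    |halfChord M d| * halfChord M l = halfChord M k * |halfChord M c| := by
  obtain ⟨a, rfl⟩ := ZMod.intCast_surjective a
  obtain ⟨b, rfl⟩ := ZMod.intCast_surjective b
  rw [← Int.cast_sub, ← Int.cast_sub, superposition_eq_iff_halfChord hl.ne', sub_sub_cancel,
    sub_sub_cancel_left, halfChord_neg] at h
  simpa only [norm_mul, Complex.norm_real, norm_zpow, norm_pskRoot, one_zpow, mul_one, norm_neg,
    Real.norm_eq_abs, abs_of_nonneg hk, abs_of_pos hl] using congrArg norm h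

end PSK

theorem eq_sub_or_eq_add_of_natAbs_valMinAbs_sub {N : ℕ} {a b : ZMod N} {k : ℕ}
    (h : (a - b).valMinAbs.natAbs = k) : b = a - k ∨ b = a + k := by
  have hcast := (a - b).coe_valMinAbs
  rcases Int.natAbs_eq (a - b).valMinAbs with h' | h' <;> rw [h', h] at hcast <;> push_cast at hcast
  · exact .inl (by rw [hcast, sub_sub_cancel])
  · exact .inr (by linear_combination hcast)

theorem natAbs_eq_of_abs_halfChord_mul_eq {n k l : ℕ} {c d : ℤ} (hk : k ∈ Set.Icc 1 (2 ^ n))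
    (hl : l ∈ Set.Icc 1 (2 ^ n)) (hkl : k ≠ l) (hc : c.natAbs ≤ 2 ^ n) (hd : d.natAbs ≤ 2 ^ n)
    (h : |halfChord (2 ^ (n + 1)) d| * halfChord (2 ^ (n + 1)) l
      = halfChord (2 ^ (n + 1)) k * |halfChord (2 ^ (n + 1)) c|) :
    d = 0 ∧ c = 0 ∨ d.natAbs = k ∧ c.natAbs = l := by
  have hlt {x : ℕ} (hx : x ≤ 2 ^ n) : x < 2 ^ (n + 1) :=
    hx.trans_lt (Nat.pow_lt_pow_succ one_lt_two)
  rw [abs_halfChord (hlt hc), abs_halfChord (hlt hd)] at h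
  rcases Nat.eq_zero_or_pos d.natAbs with hd0 | hd0 <;>
    rcases Nat.eq_zero_or_pos c.natAbs with hc0 | hc0
  · exact .inl ⟨Int.natAbs_eq_zero.1 hd0, Int.natAbs_eq_zero.1 hc0⟩
  · rw [hd0, Nat.cast_zero, halfChord_zero, zero_mul] at h
    exact absurd h.symm
      (mul_pos (halfChord_natCast_pos hk) (halfChord_natCast_pos ⟨hc0, hc⟩)).ne'
  · rw [hc0, Nat.cast_zero, halfChord_zero, mul_zero] at h
    exact absurd h (mul_pos (halfChord_natCast_pos ⟨hd0, hd⟩) (halfChord_natCast_pos hl)).ne'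
  · have := halfChord_mul_halfChord_inj ⟨hd0, hd⟩ hl hk ⟨hc0, hc⟩ h
    omega

theorem differences_of_superposition_eq {n k l : ℕ} (hk : k ∈ Set.Icc 1 (2 ^ n))
    (hl : l ∈ Set.Icc 1 (2 ^ n)) (hkl : k ≠ l) {e : ℤ}
    {p p' : ZMod (2 ^ (n + 1)) × ZMod (2 ^ (n + 1))}
    (h : superposition (psk (2 ^ (n + 1))) (fadeState (2 ^ (n + 1)) k l e) p
      = superposition (psk (2 ^ (n + 1))) (fadeState (2 ^ (n + 1)) k l e) p') :
    p = p' ∨ (p'.1 = p.1 - k ∨ p'.1 = p.1 + k) ∧ (p'.2 = p.2 - l ∨ p'.2 = p.2 + l) := by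
  have hle (x : ZMod (2 ^ (n + 1))) : x.valMinAbs.natAbs ≤ 2 ^ n :=
    x.natAbs_valMinAbs_le.trans_eq (by omega)
  have habs := abs_halfChord_mul_eq_of_superposition_eq (halfChord_natCast_pos hk).le
    (halfChord_natCast_pos hl) (a := p.1) (b := p.2) (d := (p.1 - p'.1).valMinAbs)
    (c := (p.2 - p'.2).valMinAbs) (by simpa only [ZMod.coe_valMinAbs, sub_sub_cancel] using h)
  refine (natAbs_eq_of_abs_halfChord_mul_eq hk hl hkl (hle _) (hle _) habs).imp (fun h0 => ?_)
    fun hne => ⟨eq_sub_or_eq_add_of_natAbs_valMinAbs_sub hne.1,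
      eq_sub_or_eq_add_of_natAbs_valMinAbs_sub hne.2⟩
  exact Prod.ext (sub_eq_zero.1 ((ZMod.valMinAbs_eq_zero _).1 h0.1))
    (sub_eq_zero.1 ((ZMod.valMinAbs_eq_zero _).1 h0.2))

section CellPair

variable {G : Type*} [AddCommGroup G] [DecidableEq G]

/-- The two cells `(i, i - h)` and `(i - k, i - h + l)`. -/
def cellPair (k l h i : G) : Finset (G × G) :=
  {(i, i - h), (i - k, i - h + l)}

theorem mem_cellPair {k l h i : G} {p : G × G} :
    p ∈ cellPair k l h i ↔ p = (i, i - h) ∨ p = (i - k, i - h + l) := by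
  rw [cellPair, Finset.mem_insert, Finset.mem_singleton]

/-- The cells of the vertices of the vital graph. In the labelling of the theorem `(false, i)` is
the vertex `c (i + 1)`, `(true, i)` the vertex `c (M + i + 1)`; `H` is the residue `M / 2`, and `h`
is half of `k + e + l`, `e` being the phase of the fade state. -/
def vertexCells (k l H h : G) (j : Bool × G) : Finset (G × G) :=
  if j.1 then cellPair k l h j.2 else cellPair k (-l) (h - l + H) j.2

end CellPair

section PSK

variable {M : ℕ} [NeZero M] {k l e h : ℤ} {p p' : ZMod M × ZMod M}

theorem superposition_eq_of_mem_cellPair (hk : halfChord M k ≠ 0) (hl : halfChord M l ≠ 0)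
    (hh : 2 * h = k + e + l) {i : ZMod M} (hp : p ∈ cellPair (k : ZMod M) l h i)
    (hp' : p' ∈ cellPair (k : ZMod M) l h i) :
    superposition (psk M) (fadeState M k l e) p = superposition (psk M) (fadeState M k l e) p' := by
  have hpair := (superposition_eq_iff_eq_sub hk hl hh i (i - h)).2 rfl
  rcases mem_cellPair.1 hp with rfl | rfl <;> rcases mem_cellPair.1 hp' with rfl | rfl
  exacts [rfl, hpair, hpair.symm, rfl]

theorem exists_mem_cellPair (hk : halfChord M k ≠ 0) (hl : halfChord M l ≠ 0)
    (hh : 2 * h = k + e + l) (h₁ : p'.1 = p.1 - k) (h₂ : p'.2 = p.2 + l)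
    (heq : superposition (psk M) (fadeState M k l e) p
      = superposition (psk M) (fadeState M k l e) p') :
    ∃ i, p ∈ cellPair (k : ZMod M) l h i ∧ p' ∈ cellPair (k : ZMod M) l h i := by
  obtain ⟨a, b⟩ := p
  obtain ⟨a', b'⟩ := p'
  dsimp only at h₁ h₂
  subst h₁ h₂
  rw [superposition_eq_iff_eq_sub hk hl hh] at heq
  subst heq
  exact ⟨a, mem_cellPair.2 (.inl rfl), mem_cellPair.2 (.inr rfl)⟩

theorem superposition_eq_of_mem_vertexCells (hk : halfChord M k ≠ 0) (hl : halfChord M l ≠ 0)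
    (hh : 2 * h = k + e + l) {H : ℤ} (hH : 2 * H = M) {j : Bool × ZMod M}
    (hp : p ∈ vertexCells (k : ZMod M) l H h j) (hp' : p' ∈ vertexCells (k : ZMod M) l H h j) :
    superposition (psk M) (fadeState M k l e) p = superposition (psk M) (fadeState M k l e) p' := by
  obtain ⟨_ | _, i⟩ := j
  · rw [← fadeState_neg_add]
    refine superposition_eq_of_mem_cellPair (h := h - l + H) (i := i) hk
      (by rwa [halfChord_neg, neg_ne_zero]) (by linear_combination hh + hH) ?_ ?_
    · push_cast
      exact hp
    · push_cast
      exact hp'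
  · exact superposition_eq_of_mem_cellPair hk hl hh hp hp'

theorem exists_mem_vertexCells (hk : halfChord M k ≠ 0) (hl : halfChord M l ≠ 0)
    (hh : 2 * h = k + e + l) {H : ℤ} (hH : 2 * H = M) (h₁ : p'.1 = p.1 - k)
    (h₂ : p'.2 = p.2 - l ∨ p'.2 = p.2 + l)
    (heq : superposition (psk M) (fadeState M k l e) p
      = superposition (psk M) (fadeState M k l e) p') :
    ∃ j, p ∈ vertexCells (k : ZMod M) l H h j ∧ p' ∈ vertexCells (k : ZMod M) l H h j := by
  rcases h₂ with h₂ | h₂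
  · rw [← fadeState_neg_add] at heq
    obtain ⟨i, hi⟩ := exists_mem_cellPair (h := h - l + H) hk
      (by rwa [halfChord_neg, neg_ne_zero]) (by linear_combination hh + hH) h₁
      (by rw [h₂, Int.cast_neg, sub_eq_add_neg]) heq
    push_cast at hi
    exact ⟨(false, i), hi⟩
  · obtain ⟨i, hi⟩ := exists_mem_cellPair hk hl hh h₁ h₂ heq
    exact ⟨(true, i), hi⟩

end PSK

theorem superposition_eq_iff_exists_vertexCells {n k l : ℕ} (hk : k ∈ Set.Icc 1 (2 ^ n))
    (hl : l ∈ Set.Icc 1 (2 ^ n)) (hkl : k ≠ l) {e h : ℤ} (hh : 2 * h = k + e + l)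
    (p p' : ZMod (2 ^ (n + 1)) × ZMod (2 ^ (n + 1))) :
    superposition (psk (2 ^ (n + 1))) (fadeState (2 ^ (n + 1)) k l e) p
        = superposition (psk (2 ^ (n + 1))) (fadeState (2 ^ (n + 1)) k l e) p' ↔
      p = p' ∨ ∃ j, p ∈ vertexCells (k : ZMod (2 ^ (n + 1))) l (2 ^ n) h j ∧
        p' ∈ vertexCells (k : ZMod (2 ^ (n + 1))) l (2 ^ n) h j := by
  have hk0 := (halfChord_natCast_pos hk).ne'
  have hl0 := (halfChord_natCast_pos hl).ne'
  have hH : 2 * 2 ^ n = ((2 ^ (n + 1) : ℕ) : ℤ) := by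
    push_cast
    ring
  have hcollide {j} := superposition_eq_of_mem_vertexCells (p := p) (p' := p') (j := j)
    hk0 hl0 hh hH
  have hexists {q q'} := exists_mem_vertexCells (p := q) (p' := q') hk0 hl0 hh hH
  simp only [Int.cast_natCast, Int.cast_pow, Int.cast_ofNat] at hcollide hexists
  constructor
  · intro heq
    refine (differences_of_superposition_eq hk hl hkl heq).imp_right fun ⟨h₁, h₂⟩ => ?_
    rcases h₁ with h₁ | h₁
    · exact hexists h₁ h₂ heq
    · obtain ⟨j, hj', hj⟩ := hexists (q := p') (q' := p) (eq_sub_of_add_eq h₁.symm)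
        (h₂.symm.imp (fun h => eq_sub_of_add_eq h.symm) fun h => (sub_eq_iff_eq_add.1 h.symm))
        heq.symm
      exact ⟨j, hj, hj'⟩
  · rintro (rfl | ⟨j, hj, hj'⟩)
    exacts [rfl, hcollide hj hj']

section VertexCells

variable {G : Type*} [AddCommGroup G] [DecidableEq G] {k l H h i i' : G} {p : G × G}

theorem diagonal_of_mem_cellPair (hp : p ∈ cellPair k l h i) :
    p.1 = i ∧ p.2 - p.1 + h = 0 ∨ p.1 = i - k ∧ p.2 - p.1 + h = k + l := by
  rcases mem_cellPair.1 hp with rfl | rfl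
  · exact .inl ⟨rfl, by dsimp only; abel⟩
  · exact .inr ⟨rfl, by dsimp only; abel⟩

theorem eq_of_mem_cellPair (hkl : k + l ≠ 0) (hp : p ∈ cellPair k l h i)
    (hp' : p ∈ cellPair k l h i') : i = i' := by
  have hdiag := diagonal_of_mem_cellPair hp
  have hdiag' := diagonal_of_mem_cellPair hp'
  grind

theorem notMem_cellPair_skew (hH : H + H = 0) (hk : k ≠ H) (hl : l ≠ H)
    (hp : p ∈ cellPair k l h i) : p ∉ cellPair k (-l) (h - l + H) i' := by
  intro hp'
  rcases diagonal_of_mem_cellPair hp with ⟨-, hdiag⟩ | ⟨-, hdiag⟩ <;>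
    rcases diagonal_of_mem_cellPair hp' with ⟨-, hdiag'⟩ | ⟨-, hdiag'⟩
  · exact hl (by linear_combination (norm := abel) hdiag - hdiag')
  · exact hk (by linear_combination (norm := abel) hdiag - hdiag')
  · exact hk (by linear_combination (norm := abel) hdiag' - hdiag - hH)
  · exact hl (by linear_combination (norm := abel) hdiag' - hdiag - hH)

theorem two_le_card_cellPair (hkl : k + l ≠ 0) : 2 ≤ (cellPair k l h i).card := by
  refine (Finset.card_pair fun heq => hkl ?_).ge
  grind

theorem two_le_card_vertexCells (hkl : k ≠ l) (hkl' : k + l ≠ 0) (j : Bool × G) :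
    2 ≤ (vertexCells k l H h j).card := by
  obtain ⟨_ | _, i⟩ := j
  · exact two_le_card_cellPair (by rwa [← sub_eq_add_neg, sub_ne_zero])
  · exact two_le_card_cellPair hkl'

theorem eq_of_mem_vertexCells (hH : H + H = 0) (hkl : k ≠ l) (hkl' : k + l ≠ 0) (hk : k ≠ H)
    (hl : l ≠ H) {j j' : Bool × G} (hj : p ∈ vertexCells k l H h j)
    (hj' : p ∈ vertexCells k l H h j') : j = j' := by
  obtain ⟨_ | _, i⟩ := j <;> obtain ⟨_ | _, i'⟩ := j'
  · exact congrArg _ (eq_of_mem_cellPair (by rwa [← sub_eq_add_neg, sub_ne_zero]) hj hj')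
  · exact absurd hj (notMem_cellPair_skew hH hk hl hj')
  · exact absurd hj' (notMem_cellPair_skew hH hk hl hj)
  · exact congrArg _ (eq_of_mem_cellPair hkl' hj hj')

end VertexCells

theorem IsConstraint.eq_of_mem {ι : Type*} {x : ι → ℂ} {s : ℂ} {c d : Finset (ι × ι)} {p : ι × ι}
    (hc : IsConstraint x s c) (hd : IsConstraint x s d) (hpc : p ∈ c) (hpd : p ∈ d) : c = d := by
  ext q
  refine ⟨fun hq => ?_, fun hq => ?_⟩
  · by_contra hqd
    exact hd.2.2 p hpd q hqd (hc.2.1 p hpc q hq)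
  · by_contra hqc
    exact hc.2.2 p hpc q hqc (hd.2.1 p hpd q hq)

theorem mem_constraintOf {ι : Type*} [Fintype ι] (x : ι → ℂ) (s : ℂ) (p : ι × ι) :
    p ∈ (constraintOf x s p).1 :=
  Finset.mem_filter.2 ⟨Finset.mem_univ p, rfl⟩

/-- The sets `C j` are disjoint, have at least two cells, and account for all coincidences between
received signals; they are then exactly the vertices of the vital graph. -/
structure IsVitalFamily {ι J : Type*} (x : ι → ℂ) (s : ℂ) (C : J → Finset (ι × ι)) : Prop where
  superposition_eq_iff (p p' : ι × ι) : superposition x s p = superposition x s p' ↔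
    p = p' ∨ ∃ j, p ∈ C j ∧ p' ∈ C j
  eq_of_mem {p : ι × ι} {j j' : J} (hj : p ∈ C j) (hj' : p ∈ C j') : j = j'
  two_le_card (j : J) : 2 ≤ (C j).card

namespace IsVitalFamily

variable {ι J : Type*} {x : ι → ℂ} {s : ℂ} {C : J → Finset (ι × ι)}

theorem nonempty (hC : IsVitalFamily x s C) (j : J) : (C j).Nonempty :=
  Finset.card_pos.1 (two_pos.trans_le (hC.two_le_card j))

theorem isConstraint (hC : IsVitalFamily x s C) (j : J) : IsConstraint x s (C j) := by
  refine ⟨hC.nonempty j, fun p hp p' hp' => ?_, fun p hp p' hp' heq => ?_⟩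
  · exact (hC.superposition_eq_iff p p').2 (.inr ⟨j, hp, hp'⟩)
  · rcases (hC.superposition_eq_iff p p').1 heq with rfl | ⟨j', hpj', hp'j'⟩
    · exact hp' hp
    · exact hp' (hC.eq_of_mem hp hpj' ▸ hp'j')

theorem injective (hC : IsVitalFamily x s C) : Function.Injective C := fun j j' hjj' => by
  obtain ⟨p, hp⟩ := hC.nonempty j
  exact hC.eq_of_mem hp (hjj' ▸ hp)

theorem exists_eq (hC : IsVitalFamily x s C) {d : Finset (ι × ι)} (hd : IsConstraint x s d)
    (hcard : 2 ≤ d.card) : ∃ j, C j = d := by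
  obtain ⟨p, hp, p', hp', hne⟩ := Finset.one_lt_card.1 hcard
  obtain ⟨j, hj, -⟩ := ((hC.superposition_eq_iff p p').1 (hd.2.1 p hp p' hp')).resolve_left hne
  exact ⟨j, (hC.isConstraint j).eq_of_mem hd hj hp⟩

theorem isVitalLabelling (hC : IsVitalFamily x s C) {n : ℕ} {c : ℕ → Finset (ι × ι)} {lab : J → ℕ}
    (hlab : Set.BijOn lab Set.univ (Set.Icc 1 n)) (hc : ∀ j, c (lab j) = C j) :
    IsVitalLabelling x s n c := by
  refine ⟨fun v hv => ?_, fun v hv v' hv' hvv' => ?_, fun d hd => ?_⟩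
  · obtain ⟨j, -, rfl⟩ := hlab.surjOn hv
    rw [hc]
    exact ⟨hC.isConstraint j, hC.two_le_card j⟩
  · obtain ⟨j, -, rfl⟩ := hlab.surjOn hv
    obtain ⟨j', -, rfl⟩ := hlab.surjOn hv'
    rw [hc, hc] at hvv'
    rw [hC.injective hvv']
  · obtain ⟨j, hj⟩ := hC.exists_eq hd.1 hd.2
    exact ⟨lab j, hlab.mapsTo (Set.mem_univ j), (hc j).trans hj⟩

/-- The index of a vertex of the vital graph in the family `C`. -/
noncomputable def index (hC : IsVitalFamily x s C)
    (w : {c : {c : Finset (ι × ι) // IsConstraint x s c} | 2 ≤ c.1.card}) : J :=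
  (hC.exists_eq w.1.2 w.2).choose

theorem apply_index (hC : IsVitalFamily x s C)
    (w : {c : {c : Finset (ι × ι) // IsConstraint x s c} | 2 ≤ c.1.card}) :
    C (hC.index w) = w.1.1 :=
  (hC.exists_eq w.1.2 w.2).choose_spec

variable {t u : ℕ} {χ : J → Fin t} {f : ι → ι → ℕ}

/-- A colouring of the indices that extends to a Latin square gives a proper colouring of the vital
graph. -/
noncomputable def coloring (hC : IsVitalFamily x s C) (hf : IsLatinSquare u f)
    (hχ : ∀ j, ∀ p ∈ C j, f p.1 p.2 = χ j + 1) : (vitalGraph x s).Coloring (Fin t) :=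
  SimpleGraph.Coloring.mk (fun w => χ (hC.index w)) <| by
    rintro w w' ⟨hne, p, hp, p', hp', hline⟩ heq
    rw [Function.Embedding.subtype_apply, ← hC.apply_index] at hp hp'
    have hfp : f p.1 p.2 = f p'.1 p'.2 := by rw [hχ _ p hp, hχ _ p' hp', heq]
    have hpp' : p = p' := by
      rcases hline with h | h
      · rw [h] at hfp
        exact Prod.ext h (hf.2.1 _ hfp)
      · rw [h] at hfp
        exact Prod.ext (hf.2.2 _ hfp) h
    subst hpp'
    exact hne (Subtype.ext (w.1.2.eq_of_mem w'.1.2 (hC.apply_index w ▸ hp)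
      (hC.apply_index w' ▸ hp')))

theorem hasColorClasses_coloring (hC : IsVitalFamily x s C) (hf : IsLatinSquare u f)
    (hχ : ∀ j, ∀ p ∈ C j, f p.1 p.2 = χ j + 1) {n : ℕ} {c : ℕ → Finset (ι × ι)} {lab : J → ℕ}
    (hlab : Set.SurjOn lab Set.univ (Set.Icc 1 n)) (hc : ∀ j, c (lab j) = C j)
    {S : Fin t → Set ℕ} (hS : ∀ j q, χ j = q ↔ lab j ∈ S q) :
    HasColorClasses (hC.coloring hf hχ) n c S := by
  intro w v hv hwv q
  obtain ⟨j, -, rfl⟩ := hlab hv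
  have hj : hC.index w = j := hC.injective (by rw [hC.apply_index, hwv, hc])
  rw [← hS, ← hj]
  rfl

theorem completable_partialSquare_coloring [Fintype ι] (hC : IsVitalFamily x s C)
    (hf : IsLatinSquare u f) (hχ : ∀ j, ∀ p ∈ C j, f p.1 p.2 = χ j + 1) :
    Completable u (partialSquare (hC.coloring hf hχ)) := by
  refine ⟨f, hf, fun a b q hq => ?_⟩
  rw [partialSquare] at hq
  split_ifs at hq with hcard
  rw [← Option.some.inj hq]
  refine hχ _ (a, b) ?_
  rw [hC.apply_index]
  exact mem_constraintOf x s (a, b)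

end IsVitalFamily

theorem two_pow_add_self_eq_zero (n : ℕ) : (2 : ZMod (2 ^ (n + 1))) ^ n + 2 ^ n = 0 := by
  rw [← two_mul, ← pow_succ']
  exact_mod_cast ZMod.natCast_self (2 ^ (n + 1))

theorem isVitalFamily_vertexCells {n k l : ℕ} (hk : k ∈ Set.Ico 1 (2 ^ n))
    (hl : l ∈ Set.Ico 1 (2 ^ n)) (hkl : k ≠ l) {e h : ℤ} (hh : 2 * h = k + e + l) :
    IsVitalFamily (psk (2 ^ (n + 1))) (fadeState (2 ^ (n + 1)) k l e)
      (vertexCells (k : ZMod (2 ^ (n + 1))) l (2 ^ n) h) := by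
  have hcast {a b : ℕ} (ha : a < 2 ^ (n + 1)) (hb : b < 2 ^ (n + 1)) (hab : a ≠ b) :
      (a : ZMod (2 ^ (n + 1))) ≠ b := (CharP.natCast_injOn_Iio _ _).ne ha hb hab
  have : 2 ^ (n + 1) = 2 * 2 ^ n := pow_succ' 2 n
  obtain ⟨hk1, hk2⟩ := hk
  obtain ⟨hl1, hl2⟩ := hl
  have hkl' : (k : ZMod (2 ^ (n + 1))) ≠ l := hcast (by omega) (by omega) hkl
  have hkl'' : (k + l : ZMod (2 ^ (n + 1))) ≠ 0 := by
    exact_mod_cast hcast (a := k + l) (b := 0) (by omega) (by omega) (by omega)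
  have hkH : (k : ZMod (2 ^ (n + 1))) ≠ 2 ^ n := by
    exact_mod_cast hcast (b := 2 ^ n) (by omega) (by omega) hk2.ne
  have hlH : (l : ZMod (2 ^ (n + 1))) ≠ 2 ^ n := by
    exact_mod_cast hcast (b := 2 ^ n) (by omega) (by omega) hl2.ne
  exact ⟨superposition_eq_iff_exists_vertexCells ⟨hk1, hk2.le⟩ ⟨hl1, hl2.le⟩ hkl hh,
    eq_of_mem_vertexCells (two_pow_add_self_eq_zero n) hkl' hkl'' hkH hlH,
    two_le_card_vertexCells hkl' hkl''⟩

/-- The label `v` of the vertex `c v` with cells `vertexCells _ _ _ _ j`. -/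
def vertexLabel {M : ℕ} (j : Bool × ZMod M) : ℕ :=
  j.1.toNat * M + j.2.val + 1

theorem bijOn_vertexLabel (M : ℕ) [NeZero M] :
    Set.BijOn (vertexLabel (M := M)) Set.univ (Set.Icc 1 (2 * M)) := by
  refine ⟨fun ⟨b, i⟩ _ => ?_, fun ⟨b, i⟩ _ ⟨b', i'⟩ _ heq => ?_, fun v hv => ?_⟩
  · have := i.val_lt
    cases b <;> simp only [vertexLabel, Bool.toNat_false, Bool.toNat_true, Set.mem_Icc] <;> omega
  · have := i.val_lt
    have := i'.val_lt
    cases b <;> cases b' <;>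
      simp only [vertexLabel, Bool.toNat_false, Bool.toNat_true, Prod.mk.injEq, true_and,
        false_and, reduceCtorEq] at heq ⊢ <;>
      first | omega | exact ZMod.val_injective M (by omega)
  · obtain ⟨hv1, hv2⟩ := hv
    by_cases h : v ≤ M
    · refine ⟨(false, (v - 1 : ℕ)), Set.mem_univ _, ?_⟩
      rw [vertexLabel, ZMod.val_natCast_of_lt (by omega), Bool.toNat_false]
      omega
    · refine ⟨(true, (v - M - 1 : ℕ)), Set.mem_univ _, ?_⟩
      rw [vertexLabel, ZMod.val_natCast_of_lt (by omega), Bool.toNat_true]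
      omega

theorem pskConstraint_of_le {M : ℕ} {e k l h : ℤ} (hh : 2 * h = k + e + l) {i : ℕ} (hi : i < M) :
    pskConstraint M e k l (i + 1)
      = {((i : ZMod M), (i - (M / 2 : ℤ) - (h - l : ℤ) : ZMod M)),
          ((i - k : ZMod M), (i + (M / 2 : ℤ) - h : ZMod M))} := by
  have hquot : (k + e + l) / 2 = h := by omega
  have hquot' : (k + e - l) / 2 = h - l := by omega
  rw [pskConstraint, if_pos (by omega)]
  simp only [Nat.cast_add, Nat.cast_one, add_sub_cancel_right, hquot, hquot']
  push_cast
  rfl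

theorem pskConstraint_of_lt {M : ℕ} {e k l h : ℤ} (hh : 2 * h = k + e + l) (i : ℕ) :
    pskConstraint M e k l (M + i + 1)
      = {((i : ZMod M), (i - h : ZMod M)), ((i - k : ZMod M), (i - (h - l : ℤ) : ZMod M))} := by
  have hquot : (k + e + l) / 2 = h := by omega
  have hquot' : (k + e - l) / 2 = h - l := by omega
  have hi : ((M + i + 1 : ℕ) : ℤ) - M - 1 = i := by
    push_cast
    ring
  rw [pskConstraint, if_neg (by omega)]
  simp only [hi, hquot, hquot']
  push_cast
  rfl

theorem pskConstraint_vertexLabel {n : ℕ} {e k l h : ℤ} (hh : 2 * h = k + e + l)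
    (j : Bool × ZMod (2 ^ (n + 1))) :
    pskConstraint (2 ^ (n + 1)) e k l (vertexLabel j)
      = vertexCells (k : ZMod (2 ^ (n + 1))) l (2 ^ n) h j := by
  obtain ⟨_ | _, i⟩ := j
  · have hhalf : ((2 ^ (n + 1) : ℕ) : ℤ) / 2 = 2 ^ n := by
      push_cast
      omega
    have hcol : i - 2 ^ n - (h - l) = i - (h - l + 2 ^ n : ZMod (2 ^ (n + 1))) := by ring
    have hcol' : i + 2 ^ n - h = i - (h - l + 2 ^ n : ZMod (2 ^ (n + 1))) + -l := by
      linear_combination two_pow_add_self_eq_zero n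
    rw [vertexLabel, Bool.toNat_false, zero_mul, zero_add, pskConstraint_of_le hh i.val_lt, hhalf,
      ZMod.natCast_zmod_val]
    push_cast
    rw [hcol, hcol']
    rfl
  · have hcol : i - (h - l) = (i - h + l : ZMod (2 ^ (n + 1))) := by ring
    rw [vertexLabel, Bool.toNat_true, one_mul, pskConstraint_of_lt hh, ZMod.natCast_zmod_val]
    push_cast
    rw [hcol]
    rfl

theorem injective_extend {α β γ : Type*} {D : α → β} {ψ : α → γ} {rest : β → γ}
    (hD : Function.Injective D) (hψ : Function.Injective ψ) (hrest : (Set.range D)ᶜ.InjOn rest)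
    (hdisj : ∀ a, ∀ b ∉ Set.range D, ψ a ≠ rest b) :
    Function.Injective (Function.extend D ψ rest) := by
  intro b b' heq
  by_cases hb : b ∈ Set.range D <;> by_cases hb' : b' ∈ Set.range D
  · obtain ⟨a, rfl⟩ := hb
    obtain ⟨a', rfl⟩ := hb'
    rw [hD.extend_apply, hD.extend_apply] at heq
    rw [hψ heq]
  · obtain ⟨a, rfl⟩ := hb
    rw [hD.extend_apply, Function.extend_apply' _ _ _ hb'] at heq
    exact absurd heq (hdisj a b' hb')
  · obtain ⟨a', rfl⟩ := hb'
    rw [hD.extend_apply, Function.extend_apply' _ _ _ hb] at heq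
    exact absurd heq.symm (hdisj a' b hb)
  · rw [Function.extend_apply' _ _ _ hb, Function.extend_apply' _ _ _ hb'] at heq
    exact hrest hb hb' heq

theorem exists_injOn_compl_range {α β : Type*} [Fintype α] [Fintype β] {D : α → β}
    (hD : Function.Injective D) :
    ∃ rest : β → ℕ, (Set.range D)ᶜ.InjOn rest ∧
      Set.MapsTo rest (Set.range D)ᶜ (Set.Ioc (Fintype.card α) (Fintype.card β)) := by
  classical
  suffices hcard : (Set.range D)ᶜ.encard ≤ (Set.Ioc (Fintype.card α) (Fintype.card β)).encard from
    ((Set.toFinite _).exists_injOn_of_encard_le hcard).imp fun _ h => ⟨h.2, h.1⟩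
  rw [Set.encard_eq_coe_toFinset_card, Set.encard_eq_coe_toFinset_card, Set.toFinset_compl,
    Finset.card_compl, Set.toFinset_card, Set.card_range_of_injective hD, Set.toFinset_Ioc,
    Nat.card_Ioc]

section LatinSquare

variable {G ι : Type*} [AddCommGroup G] [Fintype G] [Fintype ι]

/- The remaining cyclic diagonals are filled with one new symbol each. -/
theorem exists_isLatinSquare_of_diagonals {D : ι → G} (hD : Function.Injective D) {φ : ι → G → ℕ}
    (hφ : ∀ i r, φ i r ∈ Set.Icc 1 (Fintype.card ι))
    (hrow : ∀ r, Function.Injective fun i => φ i r)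
    (hcol : ∀ c, Function.Injective fun i => φ i (c - D i)) :
    ∃ f, IsLatinSquare (Fintype.card G) f ∧ ∀ i r, f r (r + D i) = φ i r := by
  obtain ⟨rest, hinj, hrest⟩ := exists_injOn_compl_range hD
  have hdisj {ψ : ι → ℕ} (hψ : ∀ i, ψ i ≤ Fintype.card ι) (i : ι) (b : G) (hb : b ∉ Set.range D) :
      ψ i ≠ rest b := ((hψ i).trans_lt (hrest hb).1).ne
  refine ⟨fun a b => Function.extend D (φ · a) rest (b - a),
    ⟨fun a b => ?_, fun a => ?_, fun b => ?_⟩, fun i r => ?_⟩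
  · beta_reduce
    by_cases hb : b - a ∈ Set.range D
    · obtain ⟨i, hi⟩ := hb
      rw [← hi, hD.extend_apply]
      exact ⟨(hφ i a).1, (hφ i a).2.trans (Fintype.card_le_of_injective D hD)⟩
    · rw [Function.extend_apply' _ _ _ hb]
      exact ⟨Nat.one_le_of_lt (hrest hb).1, (hrest hb).2⟩
  · exact (injective_extend hD (hrow a) hinj (hdisj fun i => (hφ i a).2)).comp
      sub_left_injective
  · have hcolumn : (fun a => Function.extend D (φ · a) rest (b - a))
        = fun a => Function.extend D (fun i => φ i (b - D i)) rest (b - a) := by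
      funext a
      by_cases hb : b - a ∈ Set.range D
      · obtain ⟨i, hi⟩ := hb
        rw [← hi, hD.extend_apply, hD.extend_apply, hi, sub_sub_cancel]
      · rw [Function.extend_apply' _ _ _ hb, Function.extend_apply' _ _ _ hb]
    rw [hcolumn]
    exact (injective_extend hD (hcol b) hinj (hdisj fun i => (hφ i _).2)).comp
      sub_right_injective
  · beta_reduce
    rw [add_sub_cancel_left, hD.extend_apply]

end LatinSquare

section Completion

variable {G : Type*} [AddCommGroup G] {K L H : G} {g : G → Fin 4} {v w : ℤ × ℤ × ℤ}

/-- The element `v₁ K + v₂ L + v₃ H`. -/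
def combination (K L H : G) (v : ℤ × ℤ × ℤ) : G :=
  v.1 • K + v.2.1 • L + v.2.2 • H

theorem combination_sub (K L H : G) (v w : ℤ × ℤ × ℤ) :
    combination K L H (v - w) = combination K L H v - combination K L H w := by
  simp only [combination, Prod.fst_sub, Prod.snd_sub, sub_smul]
  abel

/-- The coefficient vectors `v` for which `combination K L H v` is bound to be an odd multiple of
the power of two that exactly divides `K` or of the one that exactly divides `L`, when these two
powers increase from `K` to `L` to `H`. -/
def IsSeparating (v : ℤ × ℤ × ℤ) : Prop :=
  Odd v.1 ∨ v.1 = 0 ∧ Odd v.2.1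

instance : DecidablePred IsSeparating := fun v =>
  inferInstanceAs (Decidable (Odd v.1 ∨ v.1 = 0 ∧ Odd v.2.1))

/-- A colouring of `G` with four colours which separates the elements that differ by a separating
combination of `K`, `L` and the involution `H`. -/
structure IsSeparatingColoring (K L H : G) (g : G → Fin 4) : Prop where
  add_self : H + H = 0
  ne_zero : H ≠ 0
  add_self_ne_zero : K + K ≠ 0
  add_self_ne : K + K ≠ H
  apply_add_involution : ∀ r, g (r + H) = g r
  apply_ne : ∀ v, IsSeparating v → ∀ r, g (r + combination K L H v) ≠ g r

namespace IsSeparatingColoring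

theorem combination_ne_zero (hg : IsSeparatingColoring K L H g) (hv : IsSeparating v) :
    combination K L H v ≠ 0 := fun hzero => by
  simpa only [hzero, add_zero, ne_eq, not_true_eq_false] using hg.apply_ne v hv 0

theorem apply_combination_ne (hg : IsSeparatingColoring K L H g) (hvw : IsSeparating (v - w))
    (r : G) : g (r + combination K L H v) ≠ g (r + combination K L H w) := by
  have := hg.apply_ne _ hvw (r + combination K L H w)
  rwa [combination_sub, add_add_sub_cancel, add_comm, add_comm _ r] at this

theorem zsmul_eq_zero_of_even (hg : IsSeparatingColoring K L H g) {c : ℤ} (hc : Even c) :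
    c • H = 0 := by
  obtain ⟨c, rfl⟩ := hc
  rw [add_smul, ← smul_add, hg.add_self, smul_zero]

theorem zsmul_eq_of_odd (hg : IsSeparatingColoring K L H g) {c : ℤ} (hc : Odd c) : c • H = H := by
  obtain ⟨c, rfl⟩ := hc
  rw [add_smul, one_smul, hg.zsmul_eq_zero_of_even (even_two_mul c), zero_add]

theorem exists_ne_zsmul (hg : IsSeparatingColoring K L H g) (r : G) :
    ∃ x : Fin 2, r ≠ (x : ℤ) • H := by
  by_contra! h
  have := (h 0).symm.trans (h 1)
  simp only [Fin.val_zero, Fin.val_one, Nat.cast_zero, Nat.cast_one, zero_smul, one_smul] at this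
  exact hg.ne_zero this.symm

end IsSeparatingColoring

/-- The eight symbols are split into two groups of four, the symbols of a group being the colours
of the vertices of the same kind. On the diagonal `symbolDiagonal x z (t, i)`, all symbols belong to
the group `t`. The diagonals with `i ≤ 1` are those that meet the vertices of the vital graph. -/
def symbolDiagonal (x z : ℤ) : Bool × Fin 4 → ℤ × ℤ × ℤ
  | (false, i) => ![(0, 0, 0), (1, -1, 0), (-1, 0, x), (0, -1, 0)] i
  | (true, i) => ![(0, -1, 1), (1, 0, 1), (-1, -1, 1 + z), (0, 0, 1)] i

/-- The symbol in row `r` of the diagonal `symbolDiagonal x z (t, i)` is the colour of the residue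
obtained from `r` by this shift. -/
def symbolShift (x z : ℤ) : Bool × Fin 4 → ℤ × ℤ × ℤ
  | (false, i) => ![(0, 0, 0), (1, 0, 0), (0, 1, x), (1, -1, 0)] i
  | (true, i) => ![(0, 0, 0), (1, 0, 0), (0, -1, z), (1, 1, 0)] i

theorem isSeparating_symbolShift_sub (x z : Fin 2) (t : Bool) {i i' : Fin 4} (hi : i ≠ i') :
    IsSeparating (symbolShift x z (t, i) - symbolShift x z (t, i')) := by
  decide +revert

theorem isSeparating_symbolShift_sub_symbolDiagonal_sub (x z : Fin 2) (t : Bool) {i i' : Fin 4}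
    (hi : i ≠ i') :
    IsSeparating ((symbolShift x z (t, i) - symbolDiagonal x z (t, i))
      - (symbolShift x z (t, i') - symbolDiagonal x z (t, i'))) := by
  decide +revert

/-- Coefficient vectors of combinations of `K`, `L`, `H` that do not vanish, as soon as the numbers
`x` and `z` are such that `2 K - L - x H` and `2 K + L - z H` do not vanish. -/
def IsNonvanishing (x z : ℤ) (v : ℤ × ℤ × ℤ) : Prop :=
  IsSeparating v ∨ v.1 = 0 ∧ v.2.1 = 0 ∧ Odd v.2.2 ∨ v.1 = 2 ∧ v.2.1 = 0 ∨
    v = (2, -1, -x) ∨ v = (2, 1, -z)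

instance (x z : ℤ) : DecidablePred (IsNonvanishing x z) := fun _ =>
  inferInstanceAs (Decidable (_ ∨ _ ∨ _ ∨ _ ∨ _))

theorem isNonvanishing_symbolDiagonal_sub (x z : Fin 2) {s s' : Bool × Fin 4} (hs : s ≠ s') :
    IsNonvanishing x z (symbolDiagonal x z s - symbolDiagonal x z s') ∨
      IsNonvanishing x z (symbolDiagonal x z s' - symbolDiagonal x z s) := by
  decide +revert

namespace IsSeparatingColoring

theorem combination_ne_zero_of_isNonvanishing (hg : IsSeparatingColoring K L H g) {x z : ℤ}
    (hx : K + K - L ≠ x • H) (hz : K + K + L ≠ z • H) (hv : IsNonvanishing x z v) :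
    combination K L H v ≠ 0 := by
  obtain ⟨a, b, c⟩ := v
  rcases hv with hv | ⟨rfl, rfl, hc⟩ | ⟨rfl, rfl⟩ | hv | hv
  · exact hg.combination_ne_zero hv
  · simpa only [combination, zero_smul, zero_add, hg.zsmul_eq_of_odd hc] using hg.ne_zero
  · rw [combination, two_zsmul, zero_smul, add_zero]
    obtain hc | hc := c.even_or_odd
    · rw [hg.zsmul_eq_zero_of_even hc, add_zero]
      exact hg.add_self_ne_zero
    · rw [hg.zsmul_eq_of_odd hc, ← hg.add_self, add_ne_add_left]
      exact hg.add_self_ne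
  · obtain ⟨rfl, rfl, rfl⟩ := by simpa only [Prod.mk.injEq] using hv
    simpa only [combination, two_zsmul, neg_smul, one_smul, ← sub_eq_add_neg, sub_ne_zero] using hx
  · obtain ⟨rfl, rfl, rfl⟩ := by simpa only [Prod.mk.injEq] using hv
    simpa only [combination, two_zsmul, neg_smul, one_smul, ← sub_eq_add_neg, sub_ne_zero] using hz

theorem injective_combination_symbolDiagonal (hg : IsSeparatingColoring K L H g) {x z : Fin 2}
    (hx : K + K - L ≠ (x : ℤ) • H) (hz : K + K + L ≠ (z : ℤ) • H) :
    Function.Injective fun s => combination K L H (symbolDiagonal x z s) := fun s s' heq => by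
  by_contra hs
  have heq : combination K L H (symbolDiagonal x z s) = combination K L H (symbolDiagonal x z s') :=
    heq
  rcases isNonvanishing_symbolDiagonal_sub x z hs with h | h <;>
    refine hg.combination_ne_zero_of_isNonvanishing hx hz h ?_ <;>
    rw [combination_sub, heq, sub_self]

end IsSeparatingColoring

theorem exists_symbolDiagonal_of_mem_vertexCells [DecidableEq G] {h : G} (x z : ℤ) {j : Bool × G}
    {p : G × G} (hp : p ∈ vertexCells K L H h j) :
    ∃ i, p.2 = p.1 + (combination K L H (symbolDiagonal x z (j.1, i)) - (h - L + H)) ∧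
      p.1 + combination K L H (symbolShift x z (j.1, i)) = j.2 := by
  obtain ⟨_ | _, i⟩ := j <;> rcases mem_cellPair.1 hp with rfl | rfl
  on_goal 1 => use 0
  on_goal 2 => use 1
  on_goal 3 => use 0
  on_goal 4 => use 1
  all_goals
    simp only [symbolDiagonal, symbolShift, combination, zero_smul, Matrix.cons_val_zero,
      Matrix.cons_val_one]
    constructor <;> abel

theorem exists_mem_vertexCells_swap [DecidableEq G] (hH : H + H = 0) {h : G} {j : Bool × G}
    {p : G × G} (hp : p ∈ vertexCells K L H h j) :
    ∃ i, (i = j.2 ∨ i = j.2 + H) ∧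
      (p.2 + (h - L + H), p.1 + (h - L + H)) ∈ vertexCells L K H (K + L - h) (j.1, i) := by
  have : H = -H := eq_neg_of_add_eq_zero_left hH
  obtain ⟨_ | _, i⟩ := j
  · refine ⟨i, Or.inl rfl, mem_cellPair.2 ((mem_cellPair.1 hp).imp ?_ ?_)⟩ <;>
    · rintro rfl
      rw [Prod.mk.injEq]
      constructor <;> grind
  · refine ⟨i + H, Or.inr rfl, mem_cellPair.2 ((mem_cellPair.1 hp).symm.imp ?_ ?_)⟩ <;>
    · rintro rfl
      rw [Prod.mk.injEq]
      constructor <;> grind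

end Completion

section VertexColor

variable {G : Type*} {g : G → Fin 4}

/-- The colour of the vertices with cells `vertexCells _ _ _ _ j`: colours `0, …, 3` for one kind of
vertices, colours `4, …, 7` for the other one. -/
def vertexColor (g : G → Fin 4) (j : Bool × G) : Fin 8 :=
  finProdFinEquiv (finTwoEquiv.symm j.1, g j.2)

theorem vertexColor_eq_iff {j j' : Bool × G} :
    vertexColor g j = vertexColor g j' ↔ j.1 = j'.1 ∧ g j.2 = g j'.2 := by
  rw [vertexColor, vertexColor, EmbeddingLike.apply_eq_iff_eq, Prod.mk.injEq,
    EmbeddingLike.apply_eq_iff_eq]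

theorem injective_vertexColor {r : Bool × Fin 4 → G}
    (hr : ∀ t i i', i ≠ i' → g (r (t, i)) ≠ g (r (t, i'))) :
    Function.Injective fun s => (vertexColor g (s.1, r s) : ℕ) + 1 := by
  rintro ⟨t, i⟩ ⟨t', i'⟩ heq
  obtain ⟨ht, hcolor⟩ := vertexColor_eq_iff.1 (Fin.ext (Nat.succ_injective heq))
  obtain rfl : t = t' := ht
  exact congrArg _ (not_imp_not.1 (hr t i i') hcolor)

theorem IsSeparatingColoring.exists_isLatinSquare [AddCommGroup G] [Fintype G] [DecidableEq G]
    {K L H : G} (hg : IsSeparatingColoring K L H g) (h : G) :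
    ∃ f, IsLatinSquare (Fintype.card G) f ∧
      ∀ j, ∀ p ∈ vertexCells K L H h j, f p.1 p.2 = vertexColor g j + 1 := by
  obtain ⟨x, hx⟩ := hg.exists_ne_zsmul (K + K - L)
  obtain ⟨z, hz⟩ := hg.exists_ne_zsmul (K + K + L)
  let shift (s : Bool × Fin 4) : G := combination K L H (symbolShift x z s)
  let diagonal (s : Bool × Fin 4) : G := combination K L H (symbolDiagonal x z s) - (h - L + H)
  have hcol (c : G) (t : Bool) (i i' : Fin 4) (hi : i ≠ i') :
      g (c - diagonal (t, i) + shift (t, i)) ≠ g (c - diagonal (t, i') + shift (t, i')) := by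
    have hsub (s : Bool × Fin 4) : c - diagonal s + shift s = c + (h - L + H)
        + combination K L H (symbolShift x z s - symbolDiagonal x z s) := by
      simp only [shift, diagonal, combination_sub]
      abel
    rw [hsub, hsub]
    exact hg.apply_combination_ne (isSeparating_symbolShift_sub_symbolDiagonal_sub x z t hi) _
  obtain ⟨f, hf, hfill⟩ := exists_isLatinSquare_of_diagonals (D := diagonal)
    (φ := fun s r => vertexColor g (s.1, r + shift s) + 1)
    (sub_left_injective.comp (hg.injective_combination_symbolDiagonal hx hz))
    (fun s r => ⟨Nat.succ_pos _, (vertexColor g _).isLt⟩)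
    (fun r => injective_vertexColor fun t i i' hi =>
      hg.apply_combination_ne (isSeparating_symbolShift_sub x z t hi) r)
    (fun c => injective_vertexColor (hcol c))
  refine ⟨f, hf, fun j p hp => ?_⟩
  obtain ⟨i, hdiagonal, hshift⟩ := exists_symbolDiagonal_of_mem_vertexCells x z hp
  rw [hdiagonal, hfill, hshift]

theorem IsSeparatingColoring.exists_isLatinSquare_swap [AddCommGroup G] [Fintype G] [DecidableEq G]
    {K L H : G} (hg : IsSeparatingColoring L K H g) (h : G) :
    ∃ f, IsLatinSquare (Fintype.card G) f ∧
      ∀ j, ∀ p ∈ vertexCells K L H h j, f p.1 p.2 = vertexColor g j + 1 := by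
  obtain ⟨f, ⟨hsymbols, hrow, hcol⟩, hfill⟩ := hg.exists_isLatinSquare (K + L - h)
  refine ⟨fun a b => f (b + (h - L + H)) (a + (h - L + H)),
    ⟨fun a b => hsymbols _ _, fun a => (hcol _).comp (add_left_injective _),
      fun b => (hrow _).comp (add_left_injective _)⟩, fun j p hp => ?_⟩
  obtain ⟨i, hi, hmem⟩ := exists_mem_vertexCells_swap hg.add_self hp
  have hcolor : g i = g j.2 := by
    rcases hi with rfl | rfl
    exacts [rfl, hg.apply_add_involution _]
  exact (hfill _ _ hmem).trans (congrArg (fun c : Fin 8 => (c : ℕ) + 1)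
    (vertexColor_eq_iff.2 ⟨rfl, hcolor⟩))

end VertexColor

section Digits

variable {n u w p q : ℕ}

theorem val_natCast_div_two_pow_mod_two (hu : u ≤ n) (a : ℕ) :
    (a : ZMod (2 ^ (n + 1))).val / 2 ^ u % 2 = a / 2 ^ u % 2 := by
  obtain ⟨d, rfl⟩ := Nat.exists_eq_add_of_le hu
  rw [ZMod.val_natCast, add_assoc, pow_add, Nat.mod_mul_right_div_self, pow_succ',
    Nat.mod_mul_right_mod]

theorem val_add_two_pow_mul_odd_div_mod_two_ne (hu : u ≤ n) (r c : ZMod (2 ^ (n + 1))) :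
    (r + 2 ^ u * (2 * c + 1)).val / 2 ^ u % 2 ≠ r.val / 2 ^ u % 2 := by
  obtain ⟨a, rfl⟩ := ZMod.natCast_zmod_surjective r
  obtain ⟨b, rfl⟩ := ZMod.natCast_zmod_surjective c
  have hflip : (a + 2 ^ u * (2 * b + 1)) / 2 ^ u % 2 ≠ a / 2 ^ u % 2 := by
    rw [Nat.add_mul_div_left _ _ (Nat.two_pow_pos u)]
    omega
  rw [← val_natCast_div_two_pow_mod_two hu a, ← val_natCast_div_two_pow_mod_two hu] at hflip
  exact_mod_cast hflip

theorem val_add_two_pow_div_mod_two (hu : u < n) (r : ZMod (2 ^ (n + 1))) :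
    (r + 2 ^ n).val / 2 ^ u % 2 = r.val / 2 ^ u % 2 := by
  obtain ⟨a, rfl⟩ := ZMod.natCast_zmod_surjective r
  have hperiod : (a + 2 ^ n) / 2 ^ u % 2 = a / 2 ^ u % 2 := by
    obtain ⟨d, rfl⟩ := Nat.exists_eq_add_of_lt hu
    rw [add_assoc, pow_add, Nat.add_mul_div_left _ _ (Nat.two_pow_pos u), pow_succ,
      Nat.add_mul_mod_self_right]
  rw [← val_natCast_div_two_pow_mod_two hu.le a, ← val_natCast_div_two_pow_mod_two hu.le]
    at hperiod
  exact_mod_cast hperiod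

theorem two_pow_mul_odd_ne_zero (hu : u ≤ n) (c : ZMod (2 ^ (n + 1))) :
    2 ^ u * (2 * c + 1) ≠ 0 := fun hzero => by
  simpa only [hzero, add_zero, ne_eq, not_true_eq_false] using
    val_add_two_pow_mul_odd_div_mod_two_ne hu 0 c

/-- The four-colouring of the residues by their binary digits `u` and `w`. -/
def digitColor {M : ℕ} (u w : ℕ) (r : ZMod M) : Fin 4 :=
  ⟨r.val / 2 ^ u % 2 + 2 * (r.val / 2 ^ w % 2), by omega⟩

theorem digitColor_eq_iff {M : ℕ} {r r' : ZMod M} : digitColor u w r = digitColor u w r' ↔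
    r.val / 2 ^ u % 2 = r'.val / 2 ^ u % 2 ∧ r.val / 2 ^ w % 2 = r'.val / 2 ^ w % 2 := by
  rw [digitColor, digitColor, Fin.mk.injEq]
  omega

theorem digitColor_add_two_pow_mul_odd_ne (hp : p = u ∨ p = w) (hpn : p ≤ n)
    (r c : ZMod (2 ^ (n + 1))) : digitColor u w (r + 2 ^ p * (2 * c + 1)) ≠ digitColor u w r := by
  rw [ne_eq, digitColor_eq_iff]
  rintro ⟨hu, hw⟩
  rcases hp with rfl | rfl
  exacts [val_add_two_pow_mul_odd_div_mod_two_ne hpn r c hu,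
    val_add_two_pow_mul_odd_div_mod_two_ne hpn r c hw]

theorem IsSeparating.exists_combination_eq (hpq : p < q) (hqn : q < n) (a b : ZMod (2 ^ (n + 1)))
    {v : ℤ × ℤ × ℤ} (hv : IsSeparating v) : ∃ c,
      combination (2 ^ p * (2 * a + 1)) (2 ^ q * (2 * b + 1)) (2 ^ n) v = 2 ^ p * (2 * c + 1) ∨
      combination (2 ^ p * (2 * a + 1)) (2 ^ q * (2 * b + 1)) (2 ^ n) v = 2 ^ q * (2 * c + 1) := by
  obtain ⟨d, rfl⟩ := Nat.exists_eq_add_of_lt hpq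
  obtain ⟨d', rfl⟩ := Nat.exists_eq_add_of_lt hqn
  obtain ⟨x, y, z⟩ := v
  simp only [combination, zsmul_eq_mul]
  rcases hv with ⟨x, rfl⟩ | ⟨rfl, y, rfl⟩
  · refine ⟨x * (2 * a + 1) + a + y * 2 ^ d * (2 * b + 1) + z * 2 ^ (d + d' + 1), Or.inl ?_⟩
    push_cast
    ring
  · refine ⟨y * (2 * b + 1) + b + z * 2 ^ d', Or.inr ?_⟩
    push_cast
    ring

theorem isSeparatingColoring_digitColor (hp : p = u ∨ p = w) (hq : q = u ∨ q = w) (hun : u < n)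
    (hwn : w < n) (hpq : p < q) (a b : ZMod (2 ^ (n + 1))) :
    IsSeparatingColoring (2 ^ p * (2 * a + 1)) (2 ^ q * (2 * b + 1)) (2 ^ n) (digitColor u w) := by
  have hqn : q < n := by omega
  have hdouble : 2 ^ p * (2 * a + 1) + 2 ^ p * (2 * a + 1) = 2 ^ (p + 1) * (2 * a + 1) := by ring
  refine ⟨two_pow_add_self_eq_zero n, ?_, ?_, ?_, fun r => ?_, fun v hv r => ?_⟩
  · simpa only [mul_zero, zero_add, mul_one] using
      two_pow_mul_odd_ne_zero le_rfl (0 : ZMod (2 ^ (n + 1)))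
  · rw [hdouble]
    exact two_pow_mul_odd_ne_zero (by omega) a
  · obtain ⟨d, rfl⟩ := Nat.exists_eq_add_of_lt (show p + 1 < n by omega)
    rw [hdouble, ← sub_ne_zero]
    convert two_pow_mul_odd_ne_zero (show p + 1 ≤ p + 1 + d + 1 by omega) (a - 2 ^ d) using 1
    ring
  · exact digitColor_eq_iff.2 ⟨val_add_two_pow_div_mod_two hun r, val_add_two_pow_div_mod_two hwn r⟩
  · obtain ⟨c, hc | hc⟩ := hv.exists_combination_eq hpq hqn a b <;> rw [hc]
    exacts [digitColor_add_two_pow_mul_odd_ne hp (by omega) r c,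
      digitColor_add_two_pow_mul_odd_ne hq hqn.le r c]

theorem exists_isLatinSquare_digitColor {k l : ℕ} (hp : p = u ∨ p = w) (hq : q = u ∨ q = w)
    (hun : u < n) (hwn : w < n) (hpq : p ≠ q) {a b : ℕ} (ha : Odd a) (hb : Odd b)
    (hk : k = 2 ^ p * a) (hl : l = 2 ^ q * b) (h : ZMod (2 ^ (n + 1))) :
    ∃ f, IsLatinSquare (2 ^ (n + 1)) f ∧ ∀ j,
      ∀ c ∈ vertexCells (k : ZMod (2 ^ (n + 1))) l (2 ^ n) h j,
        f c.1 c.2 = vertexColor (digitColor u w) j + 1 := by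
  obtain ⟨a, rfl⟩ := ha
  obtain ⟨b, rfl⟩ := hb
  rw [hk, hl]
  push_cast
  have hlatin := hpq.lt_or_gt.elim
    (fun hlt => (isSeparatingColoring_digitColor hp hq hun hwn hlt a b).exists_isLatinSquare h)
    fun hlt => (isSeparatingColoring_digitColor hq hp hun hwn hlt b a).exists_isLatinSquare_swap h
  rwa [ZMod.card] at hlatin

end Digits

section ColorClasses

variable {lam m₁ m₂ m off u w d₁ d₂ : ℕ} {P : ℕ → Prop}

/-- The labels `off + r + 1`, `r < 2 ^ lam`, for which the binary digits `u` and `w` of `r` are `d₁`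
and `d₂`. -/
def digitSet (lam off u w d₁ d₂ : ℕ) : Set ℕ :=
  {v | ∃ r < 2 ^ lam, v = off + r + 1 ∧ r / 2 ^ u % 2 = d₁ ∧ r / 2 ^ w % 2 = d₂}

/-- The sets of the labels of the vertices of each of the colours `0, …, 7` when the four colours of
`vertexColor` are given by the binary digits `u` and `w`. -/
def digitClasses (lam u w : ℕ) (q : Fin 8) : Set ℕ :=
  digitSet lam (q / 4 * 2 ^ lam) u w (q % 2) (q / 2 % 2)

theorem vertexLabel_mem_digitSet_iff {j : Bool × ZMod (2 ^ lam)} {c : ℕ} :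
    vertexLabel j ∈ digitSet lam (c * 2 ^ lam) u w d₁ d₂ ↔
      j.1.toNat = c ∧ j.2.val / 2 ^ u % 2 = d₁ ∧ j.2.val / 2 ^ w % 2 = d₂ := by
  have hj := j.2.val_lt
  have hlabel {r : ℕ} (hr : r < 2 ^ lam) :
      vertexLabel j = c * 2 ^ lam + r + 1 ↔ j.1.toNat = c ∧ j.2.val = r := by
    have hdivmod := Nat.div_mod_unique (a := j.2.val + 2 ^ lam * j.1.toNat) (c := r) (d := c)
      (Nat.two_pow_pos lam)
    rw [Nat.add_mul_mod_self_left, Nat.mod_eq_of_lt hj,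
      Nat.add_mul_div_left _ _ (Nat.two_pow_pos lam), Nat.div_eq_of_lt hj, zero_add] at hdivmod
    rw [hdivmod, vertexLabel, mul_comm j.1.toNat, mul_comm c]
    omega
  constructor
  · rintro ⟨r, hr, heq, hdigits⟩
    obtain ⟨hc, rfl⟩ := (hlabel hr).1 heq
    exact ⟨hc, hdigits⟩
  · rintro ⟨hc, hdigits⟩
    exact ⟨_, hj, (hlabel hj).2 ⟨hc, rfl⟩, hdigits⟩

theorem vertexColor_digitColor_eq_iff (j : Bool × ZMod (2 ^ lam)) (q : Fin 8) :
    vertexColor (digitColor u w) j = q ↔ vertexLabel j ∈ digitClasses lam u w q := by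
  have hcolor : (vertexColor (digitColor u w) j : ℕ)
      = j.2.val / 2 ^ u % 2 + 2 * (j.2.val / 2 ^ w % 2) + 4 * j.1.toNat := by
    obtain ⟨_ | _, i⟩ := j <;> rfl
  rw [Fin.ext_iff, hcolor, digitClasses, vertexLabel_mem_digitSet_iff]
  omega

theorem add_one_mem_block2_iff {r i j : ℕ} (hm : m₁ ≤ m₂) (hi : i < 2 ^ (m₂ - m₁ + 1)) :
    off + r + 1 ∈ block2 off m₁ m₂ (i + 1) (j + 1) ↔
      r / 2 ^ m₁ % 2 ^ (m₂ - m₁ + 1) = i ∧ r / 2 ^ (m₂ + 1) = j := by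
  obtain ⟨d, rfl⟩ := Nat.exists_eq_add_of_le hm
  have hdiv : r / 2 ^ (m₁ + d + 1) = r / 2 ^ m₁ / 2 ^ (d + 1) := by
    rw [Nat.div_div_eq_div_mul, ← pow_add, add_assoc]
  have hblock : off + r + 1 ∈ block2 off m₁ (m₁ + d) (i + 1) (j + 1) ↔
      r / 2 ^ m₁ = i + 2 ^ (d + 1) * j := by
    have hpos := Nat.two_pow_pos m₁
    have hoff : j * 2 ^ (m₁ + d + 1) + i * 2 ^ m₁ = (i + 2 ^ (d + 1) * j) * 2 ^ m₁ := by ring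
    rw [Nat.div_eq_iff hpos, block2, Set.mem_Icc, add_tsub_cancel_right, add_tsub_cancel_right,
      ← hoff, add_mul i 1]
    omega
  rw [add_tsub_cancel_left] at hi ⊢
  rw [hblock, hdiv]
  generalize r / 2 ^ m₁ = t
  constructor
  · rintro rfl
    rw [Nat.add_mul_mod_self_left, Nat.mod_eq_of_lt hi,
      Nat.add_mul_div_left _ _ (Nat.two_pow_pos _), Nat.div_eq_of_lt hi, zero_add]
    exact ⟨rfl, rfl⟩
  · rintro ⟨rfl, rfl⟩
    exact (Nat.mod_add_div _ _).symm

theorem blockUnion2_eq_digitSet (h₁ : m₁ < m₂) (h₂ : m₂ < lam) (hd₂ : d₂ < 2)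
    (hP : ∀ i, P (i + 1) ↔ i % 2 = d₁) :
    blockUnion2 lam m₁ m₂ off (d₂ * 2 ^ (m₂ - m₁) + 1) ((d₂ + 1) * 2 ^ (m₂ - m₁)) P
      = digitSet lam off m₁ m₂ d₁ d₂ := by
  have hmod (r : ℕ) : r / 2 ^ m₁ % 2 ^ (m₂ - m₁ + 1) % 2 = r / 2 ^ m₁ % 2 :=
    Nat.mod_mod_of_dvd _ (dvd_pow_self 2 (Nat.succ_ne_zero _))
  have hdiv (r : ℕ) : r / 2 ^ m₁ % 2 ^ (m₂ - m₁ + 1) / 2 ^ (m₂ - m₁) = r / 2 ^ m₂ % 2 := by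
    rw [pow_succ, Nat.mod_mul_right_div_self, Nat.div_div_eq_div_mul, ← pow_add,
      Nat.add_sub_of_le h₁.le]
  have hlt (r : ℕ) : r / 2 ^ (m₂ + 1) < 2 ^ (lam - m₂ - 1) ↔ r < 2 ^ lam := by
    rw [Nat.div_lt_iff_lt_mul (Nat.two_pow_pos _), ← pow_add]
    congr! 2
    omega
  have hrange (i : ℕ) : d₂ * 2 ^ (m₂ - m₁) + 1 ≤ i + 1 ∧ i + 1 ≤ (d₂ + 1) * 2 ^ (m₂ - m₁) ↔
      i / 2 ^ (m₂ - m₁) = d₂ := by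
    have := Nat.two_pow_pos (m₂ - m₁)
    rw [Nat.div_eq_iff this, add_mul]
    omega
  ext v
  constructor
  · rintro ⟨i, j, hlo, hhi, hi, hj₁, hj₂, hv⟩
    obtain ⟨i, rfl⟩ := Nat.exists_eq_succ_of_ne_zero (Nat.ne_zero_of_lt hlo)
    obtain ⟨j, rfl⟩ := Nat.exists_eq_succ_of_ne_zero (Nat.ne_zero_of_lt hj₁)
    obtain ⟨r, rfl⟩ := Nat.exists_eq_add_of_lt (show off < v by have := hv.1; omega)
    have hi' : i < 2 ^ (m₂ - m₁ + 1) := by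
      rw [pow_succ']
      exact hhi.trans (Nat.mul_le_mul_right _ hd₂)
    obtain ⟨rfl, rfl⟩ := (add_one_mem_block2_iff h₁.le hi').1 hv
    refine ⟨r, (hlt r).1 hj₂, rfl, ?_, ?_⟩
    · rw [← hmod, ← hP]
      exact hi
    · rw [← hdiv, ← hrange]
      exact ⟨hlo, hhi⟩
  · rintro ⟨r, hr, rfl, rfl, rfl⟩
    have hi : r / 2 ^ m₁ % 2 ^ (m₂ - m₁ + 1) < 2 ^ (m₂ - m₁ + 1) :=
      Nat.mod_lt _ (Nat.two_pow_pos _)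
    have := (hrange _).2 (hdiv r)
    exact ⟨_, r / 2 ^ (m₂ + 1) + 1, this.1, this.2, (hP _).2 (hmod r), Nat.succ_pos _,
      (hlt r).2 hr, (add_one_mem_block2_iff h₁.le hi).2 ⟨rfl, rfl⟩⟩

theorem blockUnion1_eq_digitSet (hm : 1 ≤ m) (hlam : m ≤ lam) (hd₂ : d₂ < 2)
    (hP : ∀ i, P (i + 1) ↔ i % 2 = d₁) :
    blockUnion1 lam m off (d₂ + 1) P = digitSet lam off m 0 d₁ d₂ := by
  have hlt (r : ℕ) : r / 2 ^ m < 2 ^ (lam - m) ↔ r < 2 ^ lam := by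
    rw [Nat.div_lt_iff_lt_mul (Nat.two_pow_pos _), ← pow_add, Nat.sub_add_cancel hlam]
  have hdvd (i : ℕ) : 2 ∣ i * 2 ^ m := (dvd_pow_self 2 (Nat.ne_zero_of_lt hm)).mul_left i
  have hdiv (r i : ℕ) : r / 2 ^ m = i ↔ i * 2 ^ m ≤ r ∧ r < (i + 1) * 2 ^ m :=
    (Nat.div_eq_iff (Nat.two_pow_pos m)).trans (by have := Nat.two_pow_pos m; rw [add_mul]; omega)
  ext v
  constructor
  · rintro ⟨i, hi₁, hi₂, hi, t, rfl, hle⟩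
    obtain ⟨i, rfl⟩ : ∃ i', i = i' + 1 := ⟨i - 1, by omega⟩
    rw [add_tsub_cancel_right] at hle ⊢
    have hquot := (hdiv (i * 2 ^ m + d₂ + 2 * t) i).2 ⟨by omega, by omega⟩
    have := hdvd i
    refine ⟨_, (hlt _).1 (hquot.trans_lt hi₂), by omega, by rw [hquot, (hP _).1 hi], ?_⟩
    rw [pow_zero, Nat.div_one]
    omega
  · rintro ⟨r, hr, rfl, rfl, rfl⟩
    obtain ⟨hr₁, hr₂⟩ := (hdiv r _).1 rfl
    have := hdvd (r / 2 ^ m)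
    refine ⟨r / 2 ^ m + 1, Nat.succ_pos _, (hlt r).2 hr, (hP _).2 rfl,
      (r - r / 2 ^ m * 2 ^ m) / 2, ?_, by omega⟩
    rw [add_tsub_cancel_right, pow_zero, Nat.div_one]
    omega

theorem odd_succ_iff (i : ℕ) : Odd (i + 1) ↔ i % 2 = 0 := by
  rw [Nat.odd_add_one, Nat.not_odd_iff]

theorem even_succ_iff (i : ℕ) : Even (i + 1) ↔ i % 2 = 1 := by
  rw [Nat.even_add_one, Nat.not_even_iff]

theorem evenClasses_eq_digitClasses (h₁ : m₁ < m₂) (h₂ : m₂ < lam) :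
    evenClasses lam m₁ m₂ = digitClasses lam m₁ m₂ := by
  have hlower {off d : ℕ} {P : ℕ → Prop} (hP : ∀ i, P (i + 1) ↔ i % 2 = d) :
      blockUnion2 lam m₁ m₂ off 1 (2 ^ (m₂ - m₁)) P = digitSet lam off m₁ m₂ d 0 := by
    simpa only [zero_mul, zero_add, one_mul] using blockUnion2_eq_digitSet h₁ h₂ two_pos hP
  have hupper {off d : ℕ} {P : ℕ → Prop} (hP : ∀ i, P (i + 1) ↔ i % 2 = d) :
      blockUnion2 lam m₁ m₂ off (2 ^ (m₂ - m₁) + 1) (2 ^ (m₂ - m₁ + 1)) P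
        = digitSet lam off m₁ m₂ d 1 := by
    simpa only [one_mul, one_add_one_eq_two, pow_succ'] using
      blockUnion2_eq_digitSet h₁ h₂ one_lt_two hP
  funext q
  fin_cases q
  on_goal 1 => refine (hlower odd_succ_iff).trans ?_
  on_goal 2 => refine (hlower even_succ_iff).trans ?_
  on_goal 3 => refine (hupper odd_succ_iff).trans ?_
  on_goal 4 => refine (hupper even_succ_iff).trans ?_
  on_goal 5 => refine (hlower odd_succ_iff).trans ?_
  on_goal 6 => refine (hlower even_succ_iff).trans ?_
  on_goal 7 => refine (hupper odd_succ_iff).trans ?_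
  on_goal 8 => refine (hupper even_succ_iff).trans ?_
  all_goals simp [digitClasses]

theorem mixedClasses_eq_digitClasses (hm : 1 ≤ m) (hlam : m ≤ lam) :
    mixedClasses lam m = digitClasses lam m 0 := by
  funext q
  fin_cases q
  all_goals
    first | refine (blockUnion1_eq_digitSet hm hlam (by simp) odd_succ_iff).trans ?_
          | refine (blockUnion1_eq_digitSet hm hlam (by simp) even_succ_iff).trans ?_
  all_goals simp [digitClasses]

end ColorClasses

theorem two_pow_mul_odd_inj {p q a b : ℕ} (ha : Odd a) (hb : Odd b)
    (heq : 2 ^ p * a = 2 ^ q * b) : p = q := by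
  have hval (r : ℕ) {c : ℕ} (hc : Odd c) : padicValNat 2 (2 ^ r * c) = r := by
    rw [padicValNat_base_pow_mul one_lt_two hc.pos.ne',
      padicValNat.eq_zero_of_not_dvd hc.not_two_dvd_nat, zero_add]
  rw [← hval p ha, heq, hval q hb]

theorem lt_of_two_pow_mul_lt {p n a : ℕ} (ha : 0 < a) (hlt : 2 ^ p * a < 2 ^ n) : p < n :=
  (Nat.pow_lt_pow_iff_right one_lt_two).1 ((Nat.le_mul_of_pos_right _ ha).trans_lt hlt)

theorem even_two_pow_mul {m : ℕ} (hm : m ≠ 0) (a : ℕ) : Even (2 ^ m * a) :=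
  (even_two.pow_of_ne_zero hm).mul_right a

theorem isVitalLabelling_and_exists_coloring {n k l p q u w a b : ℕ} (hk : k ∈ Set.Ico 1 (2 ^ n))
    (hl : l ∈ Set.Ico 1 (2 ^ n)) (ha : Odd a) (hb : Odd b) (hka : k = 2 ^ p * a)
    (hlb : l = 2 ^ q * b) (hpq : p ≠ q) (hdigits : p = u ∧ q = w ∨ p = w ∧ q = u) {e : ℤ}
    (he : Even (k + e + l)) :
    IsVitalLabelling (psk (2 ^ (n + 1))) (fadeState (2 ^ (n + 1)) k l e) (2 * 2 ^ (n + 1))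
        (pskConstraint (2 ^ (n + 1)) e k l) ∧
      ∃ κ : (vitalGraph (psk (2 ^ (n + 1))) (fadeState (2 ^ (n + 1)) k l e)).Coloring (Fin 8),
        HasColorClasses κ (2 * 2 ^ (n + 1)) (pskConstraint (2 ^ (n + 1)) e k l)
          (digitClasses (n + 1) u w) ∧
        Completable (2 ^ (n + 1)) (partialSquare κ) := by
  obtain ⟨h, hh⟩ := he.two_dvd
  have hh := hh.symm
  have hkl : k ≠ l := fun heq => hpq (two_pow_mul_odd_inj ha hb (hka ▸ hlb ▸ heq))
  have hpn : p < n := lt_of_two_pow_mul_lt ha.pos (hka ▸ hk.2)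
  have hqn : q < n := lt_of_two_pow_mul_lt hb.pos (hlb ▸ hl.2)
  have hC := isVitalFamily_vertexCells hk hl hkl hh
  have hlab := bijOn_vertexLabel (2 ^ (n + 1))
  have hc (j : Bool × ZMod (2 ^ (n + 1))) : pskConstraint (2 ^ (n + 1)) e k l (vertexLabel j)
      = vertexCells (k : ZMod (2 ^ (n + 1))) l (2 ^ n) h j := by
    rw [pskConstraint_vertexLabel hh, Int.cast_natCast, Int.cast_natCast]
  obtain ⟨f, hf, hfill⟩ := exists_isLatinSquare_digitColor (u := u) (w := w) (by tauto) (by tauto)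
    (by omega) (by omega) hpq ha hb hka hlb (h : ZMod (2 ^ (n + 1)))
  exact ⟨hC.isVitalLabelling hlab hc, hC.coloring hf hfill,
    hC.hasColorClasses_coloring hf hfill hlab.surjOn hc vertexColor_digitColor_eq_iff,
    hC.completable_partialSquare_coloring hf hfill⟩

theorem mainTheorem4 (lam : ℕ) (hlam : 3 ≤ lam) (M : ℕ) [NeZero M] (hM : M = 2 ^ lam) (k l : ℕ)
    (hk : k ∈ Set.Icc 1 (M / 2)) (hl : l ∈ Set.Icc 1 (M / 2)) (hk2 : k ≠ M / 2) (hl2 : l ≠ M / 2) :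
    (∀ m₁ m₂ a₁ a₂ : ℕ, 1 ≤ m₁ → m₁ < m₂ → Odd a₁ → Odd a₂ → k = 2 ^ m₁ * a₁ → l = 2 ^ m₂ * a₂ →
      IsVitalLabelling (psk M) (fadeEven M k l) (2 * M) (pskConstraint M 0 k l) ∧
      ∃ κ : (vitalGraph (psk M) (fadeEven M k l)).Coloring (Fin 8),
        HasColorClasses κ (2 * M) (pskConstraint M 0 k l) (evenClasses lam m₁ m₂) ∧
        Completable M (partialSquare κ)) ∧
    (∀ m a : ℕ, 1 ≤ m → Odd a → (Odd k ∧ l = 2 ^ m * a ∨ Odd l ∧ k = 2 ^ m * a) →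
      IsVitalLabelling (psk M) (fadeMixed M k l) (2 * M) (pskConstraint M 1 k l) ∧
      ∃ κ : (vitalGraph (psk M) (fadeMixed M k l)).Coloring (Fin 8),
        HasColorClasses κ (2 * M) (pskConstraint M 1 k l) (mixedClasses lam m) ∧
        Completable M (partialSquare κ)) := by
  obtain ⟨n, rfl⟩ : ∃ n, lam = n + 1 := ⟨lam - 1, by omega⟩
  subst hM
  have hhalf : 2 ^ (n + 1) / 2 = 2 ^ n := by omega
  rw [hhalf] at hk hl hk2 hl2
  have hk : k ∈ Set.Ico 1 (2 ^ n) := ⟨hk.1, lt_of_le_of_ne hk.2 hk2⟩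
  have hl : l ∈ Set.Ico 1 (2 ^ n) := ⟨hl.1, lt_of_le_of_ne hl.2 hl2⟩
  refine ⟨fun m₁ m₂ a₁ a₂ h₁ h₁₂ ha₁ ha₂ hka hla => ?_, fun m a hm ha hkl => ?_⟩
  · have hk_even : Even (k : ℤ) := (hka ▸ even_two_pow_mul (by omega) a₁ : Even k).natCast
    have hl_even : Even (l : ℤ) := (hla ▸ even_two_pow_mul (by omega) a₂ : Even l).natCast
    have hm₂ : m₂ < n := lt_of_two_pow_mul_lt ha₂.pos (hla ▸ hl.2)
    rw [← fadeState_zero, evenClasses_eq_digitClasses h₁₂ (hm₂.trans n.lt_succ_self)]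
    exact isVitalLabelling_and_exists_coloring hk hl ha₁ ha₂ hka hla h₁₂.ne (.inl ⟨rfl, rfl⟩)
      ((hk_even.add Even.zero).add hl_even)
  · have heven : Even ((2 ^ m * a : ℕ) : ℤ) := (even_two_pow_mul (by omega) a).natCast
    rcases hkl with ⟨hk_odd, hla⟩ | ⟨hl_odd, hka⟩
    · have hmn : m < n := lt_of_two_pow_mul_lt ha.pos (hla ▸ hl.2)
      rw [← fadeState_one, mixedClasses_eq_digitClasses hm (hmn.trans n.lt_succ_self).le]
      exact isVitalLabelling_and_exists_coloring hk hl hk_odd ha (one_mul k).symm hla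
        (Nat.ne_of_lt hm) (.inr ⟨rfl, rfl⟩) ((hk_odd.natCast.add_one).add (hla ▸ heven))
    · have hmn : m < n := lt_of_two_pow_mul_lt ha.pos (hka ▸ hk.2)
      rw [← fadeState_one, mixedClasses_eq_digitClasses hm (hmn.trans n.lt_succ_self).le]
      exact isVitalLabelling_and_exists_coloring hk hl ha hl_odd hka (one_mul l).symm
        (Nat.ne_of_gt hm) (.inl ⟨rfl, rfl⟩)
        ((hka ▸ heven : Even (k : ℤ)).add_one.add_odd hl_odd.natCast)
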